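/- **Quantum Chernoff bound for Gaussian states with equal covariance.** Consider a single bosonic mode on $L^2(\mathbb R)$, with $\hat q$ multiplication by $x$ and $\hat p=-i\,d/dx$. For $u=(u_1,u_2)^t\in\mathbb R^2$ let $D(u)=\exp[i(u_2\hat q-u_1\hat p)]$, i.e. $(D(u)f)(x)=e^{i(u_2x-u_1u_2/2)}f(x-u_1)$, and put $$\sigma=\begin{pmatrix}0&1\\-1&0\end{pmatrix},\quad D_r=\begin{pmatrix}e^r&0\\0&e^{-r}\end{pmatrix},\quad O_\phi=\begin{pmatrix}\cos\phi&\sin\phi\\-\sin\phi&\cos\phi\end{pmatrix},\quad S_{r,\phi}=O_\phi D_rO_\phi^t,\quad A=S_{r,\phi}S_{r,\phi}^t,$$ $\gamma_\beta=1/\tanh(\beta/2)$ and $N_{\beta,s}=(1-e^{-\beta})^s/(1-e^{-\beta s})$. A density operator $\rho$ (positive, trace class, trace one) is the Gaussian state with displacement vector $\xi\in\mathbb R^2$ and covariance matrix $\Gamma$ if $\operatorname{tr}[D(u)\rho]=\exp(-iu^t\sigma\xi-\tfrac14u^t\sigma^t\Gamma\sigma u)$ for all $u\in\mathbb R^2$.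 Let $\beta>0$, $r,\phi\in\mathbb R$, $\xi,\delta\in\mathbb R^2$, let $\rho_0$ be the Gaussian state with displacement vector $\xi$ and covariance matrix $\gamma_\beta A$, and let $\rho_1=D(\delta)\rho_0D(\delta)^\dagger$. Then for every $s\in[0,1]$ the operator $\rho_0^s\rho_1^{1-s}$ is trace class and its trace $Q_s=\operatorname{tr}(\rho_0^s\rho_1^{1-s})$ is real. For $0<s<1$, $$Q_s=\exp\!\big[-\delta^t(\gamma_{s\beta}A+\gamma_{(1-s)\beta}A)^{-1}\delta\big]=\exp\!\big[-(\gamma_{s\beta}+\gamma_{(1-s)\beta})^{-1}\,\delta^tA^{-1}\delta\big],$$ $$2N_{\beta,s}N_{\beta,1-s}=[\det(\gamma_{s\beta}A+\gamma_{(1-s)\beta}A)]^{1/2}=\gamma_{s\beta}+\gamma_{(1-s)\beta},$$ and $Q_0=Q_1=1$. The minimum of $Q_s$ over $s\in[0,1]$ is attained at $s=\tfrac12$, so that $Q=\min_{0\le s\le1}Q_s=Q_{1/2}$, and $$Q=\exp\!\Big(-\frac{1}{2\gamma_{\beta/2}}\,\delta^tA^{-1}\delta\Big)=\exp\!\Big(-\tfrac12\,\delta^tO_\phi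 D_{2r}^{-1}O_\phi^t\delta\,\tanh\tfrac\beta4\Big)=\exp\!\Big[-\tfrac{|\delta|^2}{2}\big(e^{-2r}\cos^2\theta+e^{2r}\sin^2\theta\big)\tanh\tfrac\beta4\Big],$$ where $\theta=\varphi-\phi$ for any angle $\varphi$ with $\delta=O_\varphi(|\delta|,0)^t$. -/

import Mathlib

open MeasureTheory Set
open scoped Matrix ENNReal

namespace GaussianChernoff

noncomputable section

/-! ### Trace-class operators and traces -/

section OperatorTrace

variable {H : Type} [NormedAddCommGroup H] [InnerProductSpace ℂ H] [CompleteSpace H]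

/-- Bounded operators on a Hilbert space. -/
abbrev BoundedOp (H : Type) [NormedAddCommGroup H] [InnerProductSpace ℂ H] : Type := H →L[ℂ] H

/-- Trace-class (that is, nuclear) operators on a Hilbert space:
`T = ∑ₙ |fₙ⟩⟨gₙ|` with `∑ₙ ‖fₙ‖ ‖gₙ‖ < ∞`. -/
def IsTraceClass (T : BoundedOp H) : Prop :=
  ∃ f g : ℕ → H, Summable (fun n => ‖f n‖ * ‖g n‖) ∧
    ∀ x : H, HasSum (fun n => inner ℂ (g n) x • f n) (T x)

/-- `T` is trace class with trace `t`: the sum of the diagonal matrix elements of `T` is `t`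
in every orthonormal basis. -/
def HasTrace (T : BoundedOp H) (t : ℂ) : Prop :=
  IsTraceClass T ∧
    ∀ (ι : Type) (b : HilbertBasis ι ℂ H), HasSum (fun i => inner ℂ (b i) (T (b i))) t

open Classical in
/-- The trace of a trace-class operator (and `0` for any other operator). -/
def opTrace (T : BoundedOp H) : ℂ :=
  if h : ∃ t, HasTrace T t then h.choose else 0

/-- Density operators: positive operators of trace one. -/
def IsDensityOperator (ρ : BoundedOp H) : Prop :=
  0 ≤ ρ ∧ HasTrace ρ 1

/-- The function `Q_s = tr (ρ₀ ^ s ρ₁ ^ (1 - s))` of `s`, the powers being those of the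
continuous functional calculus. -/
def chernoffQ (ρ₀ ρ₁ : BoundedOp H) (s : ℝ) : ℝ :=
  (opTrace (ρ₀ ^ s * ρ₁ ^ (1 - s))).re

end OperatorTrace

/-! ### Displacement operators of a single mode, in the Schrödinger representation -/

/-- The Hilbert space `L²(ℝ)` of a single mode; here `q̂` is multiplication by `x`
and `p̂ = -i d/dx`. -/
def Mode : Type := Lp ℂ 2 (volume : Measure ℝ)

instance : NormedAddCommGroup Mode := inferInstanceAs (NormedAddCommGroup (Lp ℂ 2 volume))

instance : InnerProductSpace ℂ Mode := inferInstanceAs (InnerProductSpace ℂ (Lp ℂ 2 volume))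

instance : CompleteSpace Mode := inferInstanceAs (CompleteSpace (Lp ℂ 2 volume))

/-- The identification of `Mode` with Mathlib's `L²(ℝ)`: the wave function of a vector. -/
def Mode.toLp : Mode ≃ₗᵢ[ℂ] Lp ℂ 2 (volume : Measure ℝ) :=
  LinearIsometryEquiv.refl ℂ (Lp ℂ 2 (volume : Measure ℝ))

/-- The phase `exp (i (u₂ x - u₁ u₂ / 2))`. -/
def weylPhase (u : Fin 2 → ℝ) (x : ℝ) : ℂ :=
  Complex.exp (Complex.I * ((u 1 * x - u 0 * u 1 / 2 : ℝ) : ℂ))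

theorem norm_weylPhase (u : Fin 2 → ℝ) (x : ℝ) : ‖weylPhase u x‖ = 1 := by
  rw [weylPhase, mul_comm]
  exact Complex.norm_exp_ofReal_mul_I _

theorem continuous_weylPhase (u : Fin 2 → ℝ) : Continuous (weylPhase u) := by
  unfold weylPhase
  fun_prop

theorem measurePreserving_sub (a : ℝ) :
    MeasurePreserving (fun x : ℝ => x - a) volume volume :=
  measurePreserving_sub_right volume a

theorem memLp_weylPhase_mul (u : Fin 2 → ℝ) (f : Lp ℂ 2 (volume : Measure ℝ)) :
    MemLp (fun x => weylPhase u x * f x) 2 (volume : Measure ℝ) := by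
  refine (memLp_congr_norm (g := f) ?_ (Lp.aestronglyMeasurable f) ?_).2 (Lp.memLp f)
  · exact (continuous_weylPhase u).aestronglyMeasurable.mul (Lp.aestronglyMeasurable f)
  · exact Filter.Eventually.of_forall fun x => by simp [norm_weylPhase]

/-- Multiplication by the phase `weylPhase u`, on `L²(ℝ)`. -/
def phaseOp (u : Fin 2 → ℝ) : Lp ℂ 2 (volume : Measure ℝ) →ₗᵢ[ℂ] Lp ℂ 2 (volume : Measure ℝ) where
  toFun f := (memLp_weylPhase_mul u f).toLp _
  map_add' f g := by
    ext1
    filter_upwards [(memLp_weylPhase_mul u (f + g)).coeFn_toLp,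
      (memLp_weylPhase_mul u f).coeFn_toLp, (memLp_weylPhase_mul u g).coeFn_toLp,
      Lp.coeFn_add f g, Lp.coeFn_add ((memLp_weylPhase_mul u f).toLp _)
        ((memLp_weylPhase_mul u g).toLp _)] with x h1 h2 h3 h4 h5
    rw [h1, h5, Pi.add_apply, h2, h3, h4, Pi.add_apply, mul_add]
  map_smul' c f := by
    ext1
    filter_upwards [(memLp_weylPhase_mul u (c • f)).coeFn_toLp,
      (memLp_weylPhase_mul u f).coeFn_toLp, Lp.coeFn_smul c f,
      Lp.coeFn_smul c ((memLp_weylPhase_mul u f).toLp _)] with x h1 h2 h3 h4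
    rw [h1, RingHom.id_apply, h4, Pi.smul_apply, h2, h3, Pi.smul_apply, smul_eq_mul,
      smul_eq_mul, mul_left_comm]
  norm_map' f := by
    change ‖(memLp_weylPhase_mul u f).toLp _‖ = ‖f‖
    rw [Lp.norm_toLp, Lp.norm_def]
    congr 1
    exact eLpNorm_congr_norm_ae (Filter.Eventually.of_forall fun x => by simp [norm_weylPhase])

/-- The displacement operator `D(u) = exp (i (u₂ q̂ - u₁ p̂))`, which on wave functions reads
`(D(u) f)(x) = exp (i (u₂ x - u₁ u₂ / 2)) f (x - u₁)`. -/
def displacement (u : Fin 2 → ℝ) : BoundedOp Mode :=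
  (Mode.toLp.symm.toLinearIsometry.comp
    (((phaseOp u).comp
      (Lp.compMeasurePreservingₗᵢ ℂ (fun x : ℝ => x - u 0) (measurePreserving_sub (u 0)))).comp
        Mode.toLp.toLinearIsometry)).toContinuousLinearMap

theorem displacement_apply (u : Fin 2 → ℝ) (f : Mode) :
    Mode.toLp (displacement u f) =ᵐ[volume] fun x =>
      Complex.exp (Complex.I * ((u 1 * x - u 0 * u 1 / 2 : ℝ) : ℂ)) * Mode.toLp f (x - u 0) := by
  have h1 := (memLp_weylPhase_mul u (Lp.compMeasurePreservingₗᵢ ℂ (fun x : ℝ => x - u 0)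
      (measurePreserving_sub (u 0)) (Mode.toLp f))).coeFn_toLp
  have h2 := Lp.coeFn_compMeasurePreserving (Mode.toLp f) (measurePreserving_sub (u 0))
  filter_upwards [h1, h2] with x h1 h2
  refine Eq.trans h1 ?_
  exact congrArg (weylPhase u x * ·) h2

/-! ### Gaussian states -/

/-- The symplectic matrix `σ`. -/
def symplecticForm : Matrix (Fin 2) (Fin 2) ℝ := !![0, 1; -1, 0]

/-- `ρ` is the (single-mode) Gaussian state with displacement vector `ξ` and covariance matrix
`Γ`: a density operator with characteristic function
`tr (D(u) ρ) = exp (-i uᵗ σ ξ - (1/4) uᵗ σᵗ Γ σ u)`. -/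
def IsGaussianState (ρ : BoundedOp Mode) (ξ : Fin 2 → ℝ) (Γ : Matrix (Fin 2) (Fin 2) ℝ) :
    Prop :=
  IsDensityOperator ρ ∧ ∀ u : Fin 2 → ℝ,
    HasTrace (displacement u * ρ)
      (Complex.exp (-Complex.I * ((u ⬝ᵥ (symplecticForm *ᵥ ξ) : ℝ) : ℂ)
        - ((1 / 4 * (u ⬝ᵥ ((symplecticFormᵀ * Γ * symplecticForm) *ᵥ u)) : ℝ) : ℂ)))

/-- `γ_β = 1 / tanh (β / 2)`; the covariance matrix of the thermal state of inverse
temperature `β > 0` is `γ_β` times the identity. -/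
def thermalGamma (β : ℝ) : ℝ := (Real.tanh (β / 2))⁻¹

/-- `D_r = diag (e^r, e^{-r})`. -/
def diagSqueeze (r : ℝ) : Matrix (Fin 2) (Fin 2) ℝ := !![Real.exp r, 0; 0, Real.exp (-r)]

/-- `O_φ`. -/
def rot (φ : ℝ) : Matrix (Fin 2) (Fin 2) ℝ :=
  !![Real.cos φ, Real.sin φ; -Real.sin φ, Real.cos φ]

/-- The symplectic matrix `S_{r,φ} = O_φ D_r O_φᵗ` of a squeezing. -/
def squeeze (r φ : ℝ) : Matrix (Fin 2) (Fin 2) ℝ := rot φ * diagSqueeze r * (rot φ)ᵀ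

/-- `A = S_{r,φ} S_{r,φ}ᵗ`. -/
def squeezeCov (r φ : ℝ) : Matrix (Fin 2) (Fin 2) ℝ := squeeze r φ * (squeeze r φ)ᵀ

/-- `N_{β,s} = (1 - e^{-β})^s / (1 - e^{-β s})`. -/
def thermalNorm (β s : ℝ) : ℝ := (1 - Real.exp (-β)) ^ s / (1 - Real.exp (-(β * s)))

end

end GaussianChernoff

open GaussianChernoff

/-!
# Overlaps of displaced Gaussian states

A Gaussian unitary, the product of a displacement and of `f ↦ a^{-1/2} exp (i k x² / 2) f (x / a)`,
turns a Gaussian state with covariance matrix `γ_β A`, `det A = 1`, into the thermal state. Because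
only `A = S Sᵗ` matters, the symplectic matrix may be taken lower triangular (the Cholesky factor
of `A`), so that a dilation and a chirp are enough. It intertwines displacements by the symplectic
map (`gaussianUnitary_mul_displacement`), hence turns the displaced state into a displaced thermal
state.

The thermal state of inverse temperature `β` is `2 sinh (β / 2) M_β`, where `M_t` is the positive
integral operator with the Mehler kernel. Two facts identify it.

* A trace class operator `∑ₙ |fₙ⟩⟨gₙ|` has the kernel `k (x, y) = ∑ₙ fₙ(x) conj (gₙ(y))`, and its
  characteristic function along a vertical line is the Fourier transform of `y ↦ k (y + b, y)`.
  Injectivity of the Fourier transform on `L¹(ℝ)` therefore recovers the operator from its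
  characteristic function (`eq_of_characteristic`), and one Gaussian integral shows that
  the characteristic function is the right one (`integral_mehler_diagonal`).
* `M_t` is itself nuclear, by expanding `exp (x y / sinh t)` in a power series
  (`exists_mehlerOp`). It acts on coherent vectors by `e_b ↦ e^{-t/2} e_{e^{-t} b}`, and these
  vectors are total; so the `M_t` form a weakly continuous semigroup. A weakly continuous semigroup
  of positive operators consists of the powers of its value at `1` (`rpow_eq_of_semigroup`), which
  gives `(c M_β)^s = c^s M_{sβ}` without diagonalizing anything.

The trace of a product of two nuclear integral operators is the integral of the product of the
kernels (`HasNuclearKernel.hasTrace_mul`). For `M_a` and a displaced `M_b` this is a Gaussian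
integral which factorizes in the coordinates `x + y` and `x - y`
(`hasTrace_mehlerOp_mul_displaced`), and yields
`Q_s = exp (-(γ_{sβ} + γ_{(1-s)β})⁻¹ δᵗ A⁻¹ δ)`. The minimum is at `s = 1 / 2` because `γ` is
midpoint convex (`two_mul_thermalGamma_le`).
-/

namespace GaussianChernoff

open scoped ComplexConjugate FourierTransform

/-! ### Nuclear expansions and traces -/

section Nuclear

variable {H : Type} [NormedAddCommGroup H] [InnerProductSpace ℂ H]

/-- `T = ∑ₙ |fₙ⟩⟨gₙ|` with `∑ₙ ‖fₙ‖ ‖gₙ‖ < ∞`. -/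
structure NuclearExpansion (T : BoundedOp H) (f g : ℕ → H) : Prop where
  summable : Summable fun n => ‖f n‖ * ‖g n‖
  hasSum : ∀ x : H, HasSum (fun n => inner ℂ (g n) x • f n) (T x)

theorem NuclearExpansion.isTraceClass {T : BoundedOp H} {f g : ℕ → H}
    (h : NuclearExpansion T f g) : IsTraceClass T :=
  ⟨f, g, h.summable, h.hasSum⟩

theorem NuclearExpansion.hasSum_inner {T : BoundedOp H} {f g : ℕ → H}
    (h : NuclearExpansion T f g) (ψ φ : H) :
    HasSum (fun n => inner ℂ ψ (f n) * inner ℂ (g n) φ) (inner ℂ ψ (T φ)) := by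
  have := (h.hasSum φ).mapL (innerSL ℂ ψ)
  simpa [inner_smul_right, mul_comm] using this

theorem NuclearExpansion.smul {T : BoundedOp H} {f g : ℕ → H}
    (h : NuclearExpansion T f g) (c : ℂ) :
    NuclearExpansion (c • T) (fun n => c • f n) g := by
  refine ⟨?_, fun x => ?_⟩
  · simpa [norm_smul, mul_assoc] using h.summable.mul_left ‖c‖
  · simpa [smul_comm c] using (h.hasSum x).const_smul c

theorem NuclearExpansion.mul_left {T : BoundedOp H} {f g : ℕ → H}
    (h : NuclearExpansion T f g) (A : BoundedOp H) :
    NuclearExpansion (A * T) (fun n => A (f n)) g := by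
  refine ⟨?_, fun x => ?_⟩
  · refine Summable.of_nonneg_of_le (fun n => by positivity) (fun n => ?_)
      (h.summable.mul_left ‖A‖)
    rw [← mul_assoc]
    gcongr
    exact A.le_opNorm _
  · simpa using (h.hasSum x).mapL A

/-- Interchange of the order of summation in an absolutely convergent double series. -/
theorem hasSum_of_hasSum_fibers {α β : Type} {F : α → β → ℂ}
    (hF : Summable fun p : α × β => F p.1 p.2) {a : α → ℂ} {b : β → ℂ}
    (h1 : ∀ n, HasSum (F n) (a n)) (h2 : ∀ i, HasSum (fun n => F n i) (b i)) :
    HasSum b (∑' n, a n) := by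
  have h3 : HasSum a (∑' p : α × β, F p.1 p.2) := hF.hasSum.prod_fiberwise h1
  have h4 : HasSum (fun p : β × α => F p.2 p.1) (∑' p : α × β, F p.1 p.2) :=
    (Equiv.prodComm β α).hasSum_iff (f := fun p : α × β => F p.1 p.2) |>.2 hF.hasSum
  rw [h3.tsum_eq]
  exact h4.prod_fiberwise h2

/-- The Parseval series of `⟨g, f⟩` is absolutely convergent, with the Cauchy-Schwarz bound. -/
theorem norm_inner_mul_inner_summable {ι : Type} (b : HilbertBasis ι ℂ H) (f g : H) :
    (Summable fun i => ‖(inner ℂ g (b i) : ℂ) * inner ℂ (b i) f‖) ∧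
      ∑' i, ‖(inner ℂ g (b i) : ℂ) * inner ℂ (b i) f‖ ≤ ‖f‖ * ‖g‖ := by
  have key (x : H) : HasSum (fun i => ‖(inner ℂ (b i) x : ℂ)‖ ^ (2 : ℝ)) (‖x‖ ^ (2 : ℝ)) := by
    have := (b.hasSum_inner_mul_inner x x).mapL Complex.reCLM
    have h2 : Complex.reCLM (inner ℂ x x) = ‖x‖ ^ (2 : ℝ) := by
      rw [inner_self_eq_norm_sq_to_K]
      norm_cast
    rw [h2] at this
    convert this using 2 with i
    rw [← inner_conj_symm x (b i), Complex.conj_mul']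
    norm_cast
  have hc (x : H) (i) : ‖(inner ℂ x (b i) : ℂ)‖ = ‖(inner ℂ (b i) x : ℂ)‖ := norm_inner_symm _ _
  have h := Real.summable_and_inner_le_Lp_mul_Lq_tsum_of_nonneg (p := 2) (q := 2)
    (f := fun i => ‖(inner ℂ (b i) g : ℂ)‖) (g := fun i => ‖(inner ℂ (b i) f : ℂ)‖)
    Real.HolderConjugate.two_two (fun i => norm_nonneg _) (fun i => norm_nonneg _)
    (key g).summable (key f).summable
  simp only [norm_mul, hc]
  refine ⟨h.1, h.2.trans_eq ?_⟩
  rw [(key g).tsum_eq, (key f).tsum_eq, ← Real.rpow_mul (norm_nonneg _),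
    ← Real.rpow_mul (norm_nonneg _)]
  norm_num
  exact mul_comm _ _

theorem HasTrace.exists_nuclearExpansion {T : BoundedOp H} {t : ℂ} (h : HasTrace T t) :
    ∃ f g, NuclearExpansion T f g :=
  let ⟨f, g, h1, h2⟩ := h.1
  ⟨f, g, h1, h2⟩

/-- `∑ₙ |fₙ⟩⟨fₙ|` is positive. -/
theorem NuclearExpansion.nonneg {T : BoundedOp H} {f : ℕ → H} (h : NuclearExpansion T f f) :
    0 ≤ T := by
  rw [ContinuousLinearMap.nonneg_iff_isPositive, ContinuousLinearMap.isPositive_iff_complex]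
  intro x
  have h1 := h.hasSum_inner x x
  have h2 : ∀ n, (inner ℂ x (f n) * inner ℂ (f n) x : ℂ) =
      ((‖(inner ℂ (f n) x : ℂ)‖ ^ 2 : ℝ) : ℂ) := by
    intro n
    rw [← inner_conj_symm x (f n), Complex.conj_mul']
    norm_cast
  simp_rw [h2] at h1
  have h3 : (inner ℂ x (T x) : ℂ) = ((∑' n, ‖(inner ℂ (f n) x : ℂ)‖ ^ 2 : ℝ) : ℂ) := by
    rw [← h1.tsum_eq, Complex.ofReal_tsum]
  rw [← inner_conj_symm, h3]
  simp only [Complex.conj_ofReal, RCLike.re_to_complex, Complex.ofReal_re]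
  exact ⟨trivial, tsum_nonneg fun n => by positivity⟩

/-- The trace of `∑ₙ |fₙ⟩⟨gₙ|` is `∑ₙ ⟨gₙ, fₙ⟩`, in every orthonormal basis. -/
theorem NuclearExpansion.hasTrace {T : BoundedOp H} {f g : ℕ → H}
    (h : NuclearExpansion T f g) : HasTrace T (∑' n, inner ℂ (g n) (f n)) := by
  refine ⟨h.isTraceClass, fun ι b => ?_⟩
  refine hasSum_of_hasSum_fibers (F := fun n i => inner ℂ (g n) (b i) * inner ℂ (b i) (f n))
    ?_ (fun n => b.hasSum_inner_mul_inner _ _) fun i => ?_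
  · apply Summable.of_norm
    rw [summable_prod_of_nonneg (fun p => norm_nonneg _)]
    exact ⟨fun n => (norm_inner_mul_inner_summable b (f n) (g n)).1,
      Summable.of_nonneg_of_le (fun n => tsum_nonneg fun i => norm_nonneg _)
        (fun n => (norm_inner_mul_inner_summable b (f n) (g n)).2) h.summable⟩
  · simpa only [mul_comm] using h.hasSum_inner (b i) (b i)

variable [CompleteSpace H]

theorem NuclearExpansion.mul_right {T : BoundedOp H} {f g : ℕ → H}
    (h : NuclearExpansion T f g) (A : BoundedOp H) :
    NuclearExpansion (T * A) f (fun n => ContinuousLinearMap.adjoint A (g n)) := by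
  refine ⟨?_, fun x => ?_⟩
  · refine Summable.of_nonneg_of_le (fun n => by positivity) (fun n => ?_)
      (h.summable.mul_left ‖ContinuousLinearMap.adjoint A‖)
    rw [mul_left_comm]
    gcongr
    exact ContinuousLinearMap.le_opNorm _ _
  · simpa [ContinuousLinearMap.adjoint_inner_left] using h.hasSum (A x)

theorem HasTrace.unique {T : BoundedOp H} {s t : ℂ} (hs : HasTrace T s) (ht : HasTrace T t) :
    s = t := by
  obtain ⟨w, b, -⟩ := exists_hilbertBasis ℂ H
  exact (hs.2 _ b).unique (ht.2 _ b)

theorem HasTrace.opTrace_eq {T : BoundedOp H} {t : ℂ} (h : HasTrace T t) : opTrace T = t := by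
  have h' : ∃ t, HasTrace T t := ⟨t, h⟩
  rw [opTrace, dif_pos h']
  exact h'.choose_spec.unique h

theorem HasTrace.tsum_eq {T : BoundedOp H} {t : ℂ} (h : HasTrace T t) {f g : ℕ → H}
    (hT : NuclearExpansion T f g) : ∑' n, inner ℂ (g n) (f n) = t :=
  hT.hasTrace.unique h

/-- Traces are invariant under conjugation by a unitary. -/
theorem HasTrace.conj {T : BoundedOp H} {t : ℂ} (h : HasTrace T t) {V : BoundedOp H}
    (hV : ContinuousLinearMap.adjoint V * V = 1) :
    HasTrace (V * T * ContinuousLinearMap.adjoint V) t := by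
  obtain ⟨f, g, hT⟩ := h.exists_nuclearExpansion
  have h1 := ((hT.mul_left V).mul_right (ContinuousLinearMap.adjoint V)).hasTrace
  have h2 (x y : H) : (inner ℂ (V x) (V y) : ℂ) = inner ℂ x y := by
    rw [← ContinuousLinearMap.adjoint_inner_right, ← mul_apply_eq_comp, hV,
      one_apply_eq_self]
  simpa [h2, h.tsum_eq hT] using h1

/-- An operator with a given nuclear expansion exists. -/
theorem exists_nuclearExpansion (f g : ℕ → H) (h : Summable fun n => ‖f n‖ * ‖g n‖) :
    ∃ T : BoundedOp H, NuclearExpansion T f g := by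
  have hs : Summable fun n => InnerProductSpace.rankOne ℂ (f n) (g n) := by
    apply Summable.of_norm
    simpa using h
  refine ⟨∑' n, InnerProductSpace.rankOne ℂ (f n) (g n), h, fun x => ?_⟩
  simpa using hs.hasSum.mapL (ContinuousLinearMap.apply ℂ H x)

end Nuclear

/-! ### Powers of positive operators -/

section Powers

variable {H : Type} [NormedAddCommGroup H] [InnerProductSpace ℂ H] [CompleteSpace H]

/-- Powers commute with conjugation by a unitary, which is a star automorphism. -/
theorem rpow_conj {T V : BoundedOp H} (hT : 0 ≤ T)
    (hV : ContinuousLinearMap.adjoint V * V = 1) (hV' : V * ContinuousLinearMap.adjoint V = 1)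
    {s : ℝ} (hs : 0 ≤ s) :
    (V * T * ContinuousLinearMap.adjoint V) ^ s =
      V * T ^ s * ContinuousLinearMap.adjoint V := by
  let u : unitary (BoundedOp H) := ⟨V, hV, hV'⟩
  have h := StarAlgHomClass.map_cfc (S := ℂ) (Unitary.conjStarAlgAut ℂ (BoundedOp H) u)
    (fun x : NNReal => x ^ s) T (NNReal.continuous_rpow_const hs).continuousOn
    (by
      have : ⇑(Unitary.conjStarAlgAut ℂ (BoundedOp H) u) = fun x => V * x * star V := by
        ext1 x; rfl
      rw [this]; fun_prop)
    hT (map_nonneg _ hT)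
  exact h.symm

theorem continuousOn_rpow_const (T : BoundedOp H) : ContinuousOn (fun s : ℝ => T ^ s) (Ioi 0) := by
  intro s hs
  apply ContinuousAt.continuousWithinAt
  refine continuousAt_cfc_fun (f := fun (s : ℝ) (x : NNReal) => x ^ s) ?_ ?_
  · rw [tendstoUniformlyOn_iff_tendstoUniformly_comp_coe]
    have : CompactSpace (spectrum NNReal T) :=
      isCompact_iff_compactSpace.1 (ContinuousFunctionalCalculus.isCompact_spectrum T)
    refine ContinuousOn.tendstoUniformly (f := fun (s : ℝ) (x : spectrum NNReal T) => (x : NNReal) ^ s)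
      (U := Ioi 0) (isOpen_Ioi.mem_nhds hs) ?_
    rintro ⟨t, x⟩ ⟨ht, -⟩
    apply ContinuousAt.continuousWithinAt
    have h1 := NNReal.continuousAt_rpow (x := (x : NNReal)) (y := t) (Or.inr ht)
    exact ContinuousAt.comp (g := fun p : NNReal × ℝ => p.1 ^ p.2)
      (f := fun p : ℝ × spectrum NNReal T => ((p.2 : NNReal), p.1)) h1 (by fun_prop)
  · filter_upwards [isOpen_Ioi.mem_nhds hs] with t ht
    exact (NNReal.continuous_rpow_const (le_of_lt ht)).continuousOn

/-- Operators are determined by their matrix elements between the vectors of a total family. -/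
theorem ext_of_inner_total {ι : Type} {e : ι → H}
    (he : ∀ φ, (∀ i, inner ℂ (e i) φ = (0 : ℂ)) → φ = 0)
    {X Y : BoundedOp H} (h : ∀ i j, (inner ℂ (e i) (X (e j)) : ℂ) = inner ℂ (e i) (Y (e j))) :
    X = Y := by
  have h1 : ∀ j, (X - Y) (e j) = 0 := fun j => he _ fun i => by
    rw [_root_.sub_apply, inner_sub_right, h, sub_self]
  have h2 : ContinuousLinearMap.adjoint (X - Y) = 0 := by
    ext ψ
    exact he _ fun j => by
      rw [ContinuousLinearMap.adjoint_inner_right, h1, inner_zero_left]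
  rw [← sub_eq_zero, ← ContinuousLinearMap.adjoint_adjoint (X - Y), h2, map_zero]

/-- A weakly continuous semigroup of positive operators consists of the powers of its value
at `1`: this holds at positive rationals by uniqueness of positive roots. -/
theorem rpow_eq_of_semigroup {ι : Type} {e : ι → H}
    (he : ∀ φ, (∀ i, inner ℂ (e i) φ = (0 : ℂ)) → φ = 0) {N : ℝ → BoundedOp H}
    (hpos : ∀ t, 0 < t → 0 ≤ N t) (hadd : ∀ s t, 0 < s → 0 < t → N (s + t) = N s * N t)
    (hcont : ∀ i j, ContinuousOn (fun t => (inner ℂ (e i) (N t (e j)) : ℂ)) (Ioi 0))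
    {s : ℝ} (hs : 0 < s) : N 1 ^ s = N s := by
  have hpow : ∀ (n : ℕ) (t : ℝ), 0 < t → N ((n + 1 : ℕ) * t) = N t ^ (n + 1) := by
    intro n t ht
    induction n with
    | zero => simp
    | succ k ih =>
      rw [pow_succ, ← ih, ← hadd _ _ (by positivity) ht]
      push_cast
      ring_nf
  -- write `q = (n + 1) t` and `1 = (d + 1) t` with `t = 1 / (d + 1)`; then `N q` and `N 1` are
  -- natural powers of `N t`
  have hrat : ∀ q : ℚ, 0 < q → N 1 ^ (q : ℝ) = N q := by
    intro q hq
    have hn : 0 < q.num := Rat.num_pos.2 hq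
    obtain ⟨n, hn'⟩ : ∃ n : ℕ, q.num = ((n + 1 : ℕ) : ℤ) := ⟨q.num.toNat - 1, by omega⟩
    obtain ⟨d, hd⟩ : ∃ d : ℕ, q.den = d + 1 := ⟨q.den - 1, by have := q.pos; omega⟩
    have hq' : (q : ℝ) = (n + 1 : ℕ) * (1 / (d + 1 : ℕ)) := by
      rw [Rat.cast_def, hn', hd]
      push_cast
      ring
    set t : ℝ := 1 / (d + 1 : ℕ) with ht
    have ht0 : 0 < t := by positivity
    have h1 : N 1 = N t ^ ((d + 1 : ℕ) : ℝ) := by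
      rw [CFC.rpow_natCast _ _ (hpos t ht0), ← hpow d t ht0]
      congr 1
      rw [ht]
      field_simp
    have h0 := hpos t ht0
    rw [hq', h1, hpow n t ht0, CFC.rpow_rpow_of_exponent_nonneg _ _ _ (by positivity) (by positivity),
      ← CFC.rpow_natCast _ _ h0]
    congr 1
    rw [ht]
    field_simp
  refine ext_of_inner_total he fun i j => ?_
  have hne : (nhdsWithin s (range ((↑) : ℚ → ℝ))).NeBot :=
    mem_closure_iff_nhdsWithin_neBot.1 (Rat.denseRange_cast s)
  have h1 : ContinuousAt (fun t : ℝ => (inner ℂ (e i) ((N 1 ^ t) (e j)) : ℂ)) s := by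
    have := (continuousOn_rpow_const (N 1)).continuousAt (isOpen_Ioi.mem_nhds hs)
    exact ContinuousAt.inner continuousAt_const (this.clm_apply continuousAt_const)
  have h2 := (hcont i j).continuousAt (isOpen_Ioi.mem_nhds hs)
  refine tendsto_nhds_unique_of_eventuallyEq (l := nhdsWithin s (range ((↑) : ℚ → ℝ)))
    (h1.tendsto.mono_left nhdsWithin_le_nhds) (h2.tendsto.mono_left nhdsWithin_le_nhds) ?_
  filter_upwards [self_mem_nhdsWithin, nhdsWithin_le_nhds (isOpen_Ioi.mem_nhds hs)]
  rintro _ ⟨q, rfl⟩ hq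
  rw [hrat q (by simpa using hq)]

end Powers

/-! ### Integration lemmas -/

/-- Termwise integration of a series with summable `L¹` norms, including integrability of the
sum. -/
theorem integrable_and_hasSum_integral {α ι : Type*} [MeasurableSpace α] {μ : Measure α}
    [Countable ι] {F : ι → α → ℂ} {k : α → ℂ} (hF : ∀ i, Integrable (F i) μ)
    (hs : Summable fun i => ∫ a, ‖F i a‖ ∂μ) (hk : ∀ᵐ a ∂μ, HasSum (fun i => F i a) (k a)) :
    Integrable k μ ∧ HasSum (fun i => ∫ a, F i a ∂μ) (∫ a, k a ∂μ) := by
  have h1 := hasSum_integral_of_summable_integral_norm hF hs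
  have h2 : ∫ a, (∑' i, F i a) ∂μ = ∫ a, k a ∂μ :=
    integral_congr_ae (hk.mono fun a ha => ha.tsum_eq)
  refine ⟨⟨?_, ?_⟩, h2 ▸ h1⟩
  · refine aestronglyMeasurable_of_tendsto_ae (Filter.atTop : Filter (Finset ι))
      (f := fun s a => ∑ i ∈ s, F i a)
      (fun s => Finset.aestronglyMeasurable_fun_sum s fun i _ => (hF i).1) ?_
    filter_upwards [hk] with a ha
    simpa [HasSum] using ha
  · have h3 : ∀ i, ∫⁻ a, ‖F i a‖ₑ ∂μ = ENNReal.ofReal (∫ a, ‖F i a‖ ∂μ) := fun i =>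
      (ofReal_integral_norm_eq_lintegral_enorm (hF i)).symm
    have h4 : ∫⁻ a, ‖k a‖ₑ ∂μ ≤ ∑' i, ∫⁻ a, ‖F i a‖ₑ ∂μ := by
      rw [← lintegral_tsum fun i => (hF i).1.enorm]
      refine lintegral_mono_ae (hk.mono fun a ha => ?_)
      rw [← ha.tsum_eq]
      exact enorm_tsum_le_tsum_enorm
    refine h4.trans_lt ?_
    simp_rw [h3]
    rw [← ENNReal.ofReal_tsum_of_nonneg (fun i => integral_nonneg fun a => norm_nonneg _) hs]
    exact ENNReal.ofReal_lt_top

/-- A series with summable `L¹` norms converges absolutely almost everywhere. -/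
theorem ae_hasSum_tsum {α ι : Type*} [MeasurableSpace α] {μ : Measure α}
    [Countable ι] {F : ι → α → ℂ} (hF : ∀ i, Integrable (F i) μ)
    (hs : Summable fun i => ∫ a, ‖F i a‖ ∂μ) :
    ∀ᵐ a ∂μ, HasSum (fun i => F i a) (∑' i, F i a) := by
  have h3 : ∀ i, ∫⁻ a, ‖F i a‖ₑ ∂μ = ENNReal.ofReal (∫ a, ‖F i a‖ ∂μ) := fun i =>
    (ofReal_integral_norm_eq_lintegral_enorm (hF i)).symm
  have h4 : ∫⁻ a, ∑' i, ‖F i a‖ₑ ∂μ ≠ ∞ := by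
    rw [lintegral_tsum fun i => (hF i).1.enorm]
    simp_rw [h3]
    rw [← ENNReal.ofReal_tsum_of_nonneg (fun i => integral_nonneg fun a => norm_nonneg _) hs]
    exact ENNReal.ofReal_ne_top
  filter_upwards [ae_lt_top' (AEMeasurable.tsum fun i => (hF i).1.enorm) h4] with a ha
  refine Summable.hasSum (Summable.of_norm ?_)
  exact NNReal.summable_coe.2 (ENNReal.tsum_coe_ne_top_iff_summable.1 ha.ne)

/-- The Fourier transform is injective on `L¹(ℝ)`. -/
theorem ae_eq_zero_of_fourier_eq_zero {h : ℝ → ℂ} (hh : Integrable h)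
    (h0 : ∀ v : ℝ, ∫ x : ℝ, Complex.exp (Complex.I * v * x) * h x = 0) : h =ᵐ[volume] 0 := by
  have hF : 𝓕 h = 0 := by
    ext w
    rw [Real.fourier_real_eq_integral_exp_smul, Pi.zero_apply, ← h0 (-2 * Real.pi * w)]
    congr 1 with x
    rw [smul_eq_mul]
    push_cast
    ring_nf
  -- test against `g = 𝓕 (𝓕⁻¹ g)`, and move the Fourier transform to `h`
  refine ae_eq_zero_of_integral_contDiff_smul_eq_zero hh.locallyIntegrable fun g g_smooth g_cpt => ?_
  have hg₁ : HasCompactSupport (Complex.ofRealCLM ∘ g) := g_cpt.comp_left rfl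
  have hg₂ : ContDiff ℝ _ (Complex.ofRealCLM ∘ g) := Complex.ofRealCLM.contDiff.comp g_smooth
  let G : SchwartzMap ℝ ℂ := hg₁.toSchwartzMap hg₂
  let G' : SchwartzMap ℝ ℂ := 𝓕⁻ G
  have h1 := VectorFourier.integral_fourierIntegral_smul_eq_flip (𝕜 := ℝ) (L := innerₗ ℝ)
    (e := Real.fourierChar)
    (μ := volume) (ν := volume)
    Real.continuous_fourierChar continuous_inner hh G'.integrable
  have h2 : (VectorFourier.fourierIntegral Real.fourierChar volume (innerₗ ℝ).flip ⇑G') = ⇑G := by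
    rw [flip_innerₗ]
    change 𝓕 (⇑G') = _
    rw [← SchwartzMap.fourier_coe, FourierTransform.fourier_fourierInv_eq]
  have h3 : VectorFourier.fourierIntegral Real.fourierChar volume (innerₗ ℝ) h = 0 := hF
  rw [h2, h3] at h1
  simp only [Pi.zero_apply, zero_smul, integral_zero] at h1
  rw [h1]
  congr 1 with x
  simp [G, mul_comm]

theorem ae_eq_of_fourier_eq {h k : ℝ → ℂ} (hh : Integrable h) (hk : Integrable k)
    (h0 : ∀ v : ℝ, ∫ x : ℝ, Complex.exp (Complex.I * v * x) * h x =
      ∫ x : ℝ, Complex.exp (Complex.I * v * x) * k x) : h =ᵐ[volume] k := by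
  have hb (v : ℝ) {f : ℝ → ℂ} (hf : Integrable f) :
      Integrable fun x : ℝ => Complex.exp (Complex.I * v * x) * f x := by
    refine hf.bdd_mul (c := 1) (by fun_prop) (Filter.Eventually.of_forall fun x => ?_)
    rw [mul_assoc, mul_comm, ← Complex.ofReal_mul, Complex.norm_exp_ofReal_mul_I]
  have := ae_eq_zero_of_fourier_eq_zero (hh.sub hk) fun v => by
    simp only [Pi.sub_apply, mul_sub]
    rw [integral_sub (hb v hh) (hb v hk), h0, sub_self]
  filter_upwards [this] with x hx
  simpa [sub_eq_zero] using hx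

/-! ### Wave functions -/

/-- The wave function of a vector. -/
noncomputable def wave (φ : Mode) : ℝ → ℂ := Mode.toLp φ

/-- The vector with a given square integrable wave function. -/
noncomputable def ofWave (f : ℝ → ℂ) (hf : MemLp f 2 (volume : Measure ℝ)) : Mode :=
  Mode.toLp.symm (hf.toLp f)

theorem wave_ofWave {f : ℝ → ℂ} (hf : MemLp f 2 (volume : Measure ℝ)) :
    wave (ofWave f hf) =ᵐ[volume] f := by
  simpa [wave, ofWave] using hf.coeFn_toLp

theorem memLp_wave (φ : Mode) : MemLp (wave φ) 2 (volume : Measure ℝ) := Lp.memLp _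

theorem mode_ext {φ ψ : Mode} (h : wave φ =ᵐ[volume] wave ψ) : φ = ψ :=
  Mode.toLp.injective (Lp.ext h)

theorem inner_eq_integral (ψ φ : Mode) :
    (inner ℂ ψ φ : ℂ) = ∫ x, conj (wave ψ x) * wave φ x := by
  rw [← Mode.toLp.inner_map_map, L2.inner_def]
  simp only [RCLike.inner_apply', wave]

theorem inner_ofWave {f : ℝ → ℂ} (hf : MemLp f 2 (volume : Measure ℝ)) (φ : Mode) :
    (inner ℂ (ofWave f hf) φ : ℂ) = ∫ x, conj (f x) * wave φ x := by
  rw [inner_eq_integral]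
  refine integral_congr_ae ?_
  filter_upwards [wave_ofWave hf] with x hx
  rw [hx]

theorem integrable_conj_mul (ψ φ : Mode) :
    Integrable (fun x => conj (wave ψ x) * wave φ x) (volume : Measure ℝ) :=
  (memLp_wave ψ).star.integrable_mul (memLp_wave φ)

theorem integral_norm_sq_wave (φ : Mode) : ∫ x, ‖wave φ x‖ ^ 2 = ‖φ‖ ^ 2 := by
  have h := inner_eq_integral φ φ
  rw [inner_self_eq_norm_sq_to_K] at h
  simp_rw [Complex.conj_mul'] at h
  norm_cast at h
  exact (Complex.ofReal_injective h).symm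

theorem integral_norm_mul_le (ψ φ : Mode) :
    ∫ x, ‖conj (wave ψ x) * wave φ x‖ ≤ ‖ψ‖ * ‖φ‖ := by
  have h := integral_mul_le_Lp_mul_Lq_of_nonneg (μ := (volume : Measure ℝ))
    Real.HolderConjugate.two_two (f := fun x => ‖wave ψ x‖) (g := fun x => ‖wave φ x‖)
    (Filter.Eventually.of_forall fun x => norm_nonneg _)
    (Filter.Eventually.of_forall fun x => norm_nonneg _)
    (by simpa using (memLp_wave ψ).norm) (by simpa using (memLp_wave φ).norm)
  simp only [norm_mul, RCLike.norm_conj]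
  refine h.trans_eq ?_
  have (χ : Mode) : (∫ x, ‖wave χ x‖ ^ (2 : ℝ)) ^ (1 / 2 : ℝ) = ‖χ‖ := by
    simp only [Real.rpow_ofNat]
    rw [integral_norm_sq_wave, ← Real.sqrt_eq_rpow, Real.sqrt_sq (norm_nonneg _)]
  rw [this, this]

theorem hasSum_of_eq {ι M : Type*} [AddCommMonoid M] [TopologicalSpace M] {f g : ι → M} {a : M}
    (h : HasSum f a) (e : ∀ i, f i = g i) : HasSum g a := by
  rwa [funext e] at h

/-! ### Displacement operators -/

theorem wave_displacement (u : Fin 2 → ℝ) (φ : Mode) :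
    wave (displacement u φ) =ᵐ[volume] fun x => weylPhase u x * wave φ (x - u 0) :=
  displacement_apply u φ

theorem wave_smul (c : ℂ) (φ : Mode) : wave (c • φ) =ᵐ[volume] fun x => c * wave φ x := by
  have h := Lp.coeFn_smul c (Mode.toLp φ)
  rw [← map_smul] at h
  exact h

theorem ae_sub_const {p : ℝ → Prop} (a : ℝ) (h : ∀ᵐ x, p x) : ∀ᵐ x : ℝ, p (x - a) :=
  (measurePreserving_sub a).quasiMeasurePreserving.ae h

/-- The Weyl relations. -/
theorem displacement_mul_displacement (u v : Fin 2 → ℝ) :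
    displacement u * displacement v =
      Complex.exp (Complex.I * (((u 1 * v 0 - u 0 * v 1) / 2 : ℝ) : ℂ)) • displacement (u + v) := by
  ext φ
  refine mode_ext ?_
  have h1 := wave_displacement u (displacement v φ)
  have h2 := ae_sub_const (u 0) (wave_displacement v φ)
  have h3 := wave_displacement (u + v) φ
  have h4 := wave_smul (Complex.exp (Complex.I * (((u 1 * v 0 - u 0 * v 1) / 2 : ℝ) : ℂ)))
    (displacement (u + v) φ)
  filter_upwards [h1, h2, h3, h4] with x h1 h2 h3 h4
  refine h1.trans (Eq.trans ?_ h4.symm)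
  rw [h2, h3]
  simp only [weylPhase, Pi.add_apply, sub_sub]
  rw [← mul_assoc, ← mul_assoc, ← Complex.exp_add, ← Complex.exp_add]
  congr 2
  push_cast
  ring

theorem displacement_zero : displacement 0 = 1 := by
  ext φ
  refine mode_ext ?_
  filter_upwards [wave_displacement 0 φ] with x hx
  rw [hx]
  simp [weylPhase]

theorem displacement_neg_mul (u : Fin 2 → ℝ) : displacement (-u) * displacement u = 1 := by
  rw [displacement_mul_displacement, neg_add_cancel, displacement_zero]
  simp [mul_comm]

theorem displacement_mul_neg (u : Fin 2 → ℝ) : displacement u * displacement (-u) = 1 := by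
  simpa using displacement_neg_mul (-u)

theorem inner_displacement (u : Fin 2 → ℝ) (φ ψ : Mode) :
    (inner ℂ (displacement u φ) (displacement u ψ) : ℂ) = inner ℂ φ ψ :=
  LinearIsometry.inner_map_map _ φ ψ

theorem norm_displacement (u : Fin 2 → ℝ) (φ : Mode) : ‖displacement u φ‖ = ‖φ‖ :=
  LinearIsometry.norm_map _ φ

theorem adjoint_displacement (u : Fin 2 → ℝ) :
    ContinuousLinearMap.adjoint (displacement u) = displacement (-u) := by
  symm
  rw [ContinuousLinearMap.eq_adjoint_iff]
  intro x y
  rw [← inner_displacement u, ← mul_apply_eq_comp, displacement_mul_neg, one_apply_eq_self]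

theorem displacement_comm (u v : Fin 2 → ℝ) :
    displacement u * displacement v =
      Complex.exp (Complex.I * ((u 1 * v 0 - u 0 * v 1 : ℝ) : ℂ)) •
        (displacement v * displacement u) := by
  rw [displacement_mul_displacement, displacement_mul_displacement v, smul_smul, ← Complex.exp_add,
    add_comm v]
  congr 2
  push_cast
  ring

/-! ### Nuclear operators with a kernel -/

/-- `T` is a nuclear integral operator with kernel `k`: `T = ∑ₙ |fₙ⟩⟨gₙ|` with
`k (x, y) = ∑ₙ fₙ(x) conj (gₙ(y))` almost everywhere. -/
def HasNuclearKernel (T : BoundedOp Mode) (k : ℝ → ℝ → ℂ) : Prop :=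
  ∃ f g : ℕ → Mode, NuclearExpansion T f g ∧
    ∀ᵐ p : ℝ × ℝ, HasSum (fun n => wave (f n) p.1 * conj (wave (g n) p.2)) (k p.1 p.2)

/-- The function `(x, y) ↦ conj ψ(x) f(x) conj g(y) φ(y)` whose integral is `⟨ψ, f⟩⟨g, φ⟩`. -/
noncomputable def innerDensity (ψ f g φ : Mode) (p : ℝ × ℝ) : ℂ :=
  (conj (wave ψ p.1) * wave f p.1) * (conj (wave g p.2) * wave φ p.2)

theorem integrable_innerDensity (ψ f g φ : Mode) : Integrable (innerDensity ψ f g φ) :=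
  (integrable_conj_mul ψ f).mul_prod (integrable_conj_mul g φ)

theorem integral_innerDensity (ψ f g φ : Mode) :
    ∫ p, innerDensity ψ f g φ p = inner ℂ ψ f * inner ℂ g φ := by
  rw [inner_eq_integral, inner_eq_integral]
  exact integral_prod_mul (fun x => conj (wave ψ x) * wave f x)
    (fun y => conj (wave g y) * wave φ y)

theorem integral_norm_innerDensity_le (ψ f g φ : Mode) :
    ∫ p, ‖innerDensity ψ f g φ p‖ ≤ (‖ψ‖ * ‖f‖) * (‖g‖ * ‖φ‖) := by
  have : ∫ p, ‖innerDensity ψ f g φ p‖ = (∫ x, ‖conj (wave ψ x) * wave f x‖) *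
      ∫ y, ‖conj (wave g y) * wave φ y‖ := by
    rw [← integral_prod_mul]
    simp only [innerDensity, norm_mul]
    rfl
  rw [this]
  exact mul_le_mul (integral_norm_mul_le _ _) (integral_norm_mul_le _ _)
    (integral_nonneg fun _ => norm_nonneg _) (by positivity)

theorem NuclearExpansion.summable_integral_norm {T : BoundedOp Mode} {f g : ℕ → Mode}
    (h : NuclearExpansion T f g) (ψ φ : Mode) :
    Summable fun n => ∫ p, ‖innerDensity ψ (f n) (g n) φ p‖ := by
  refine Summable.of_nonneg_of_le (fun n => integral_nonneg fun _ => norm_nonneg _)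
    (fun n => integral_norm_innerDensity_le _ _ _ _) ?_
  have := h.summable.mul_left (‖ψ‖ * ‖φ‖)
  refine this.congr fun n => ?_
  ring

/-- The matrix elements of a nuclear integral operator. -/
theorem HasNuclearKernel.inner_eq {T : BoundedOp Mode} {k : ℝ → ℝ → ℂ} (h : HasNuclearKernel T k)
    (ψ φ : Mode) :
    Integrable (fun p : ℝ × ℝ => conj (wave ψ p.1) * k p.1 p.2 * wave φ p.2) ∧
      (inner ℂ ψ (T φ) : ℂ) = ∫ p : ℝ × ℝ, conj (wave ψ p.1) * k p.1 p.2 * wave φ p.2 := by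
  obtain ⟨f, g, hT, hk⟩ := h
  have := integrable_and_hasSum_integral
    (k := fun p : ℝ × ℝ => conj (wave ψ p.1) * k p.1 p.2 * wave φ p.2)
    (fun n => integrable_innerDensity ψ (f n) (g n) φ) (hT.summable_integral_norm ψ φ) (by
      filter_upwards [hk] with p hp
      refine hasSum_of_eq ((hp.mul_left (conj (wave ψ p.1))).mul_right (wave φ p.2)) fun n => ?_
      simp only [innerDensity]
      ring)
  refine ⟨this.1, ?_⟩
  exact (hT.hasSum_inner ψ φ).unique
    (hasSum_of_eq this.2 fun n => integral_innerDensity _ _ _ _)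

/-- The trace of a product of nuclear integral operators. -/
theorem HasNuclearKernel.hasTrace_mul {T S : BoundedOp Mode} {k l : ℝ → ℝ → ℂ}
    (hT : HasNuclearKernel T k) (hS : HasNuclearKernel S l) :
    Integrable (fun p : ℝ × ℝ => k p.1 p.2 * l p.2 p.1) ∧
      HasTrace (T * S) (∫ p : ℝ × ℝ, k p.1 p.2 * l p.2 p.1) := by
  obtain ⟨f, g, hT, hk⟩ := hT
  obtain ⟨p, q, hS, hl⟩ := hS
  have hl' : ∀ᵐ z : ℝ × ℝ, HasSum (fun n => wave (p n) z.2 * conj (wave (q n) z.1)) (l z.2 z.1) :=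
    (Measure.measurePreserving_swap (μ := (volume : Measure ℝ))
      (ν := (volume : Measure ℝ))).quasiMeasurePreserving.ae hl
  let F : ℕ × ℕ → ℝ × ℝ → ℂ := fun m => innerDensity (q m.2) (f m.1) (g m.1) (p m.2)
  have hs : Summable fun m => ∫ z, ‖F m z‖ := by
    refine Summable.of_nonneg_of_le (fun n => integral_nonneg fun _ => norm_nonneg _)
      (fun n => integral_norm_innerDensity_le _ _ _ _) ?_
    have := hT.summable.mul_of_nonneg hS.summable (fun n => by positivity) (fun n => by positivity)
    refine this.congr fun n => ?_
    ring
  have hz : ∀ᵐ z : ℝ × ℝ, HasSum (fun m => F m z) (k z.1 z.2 * l z.2 z.1) := by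
    filter_upwards [hk, hl'] with z hz hz'
    have hm := summable_mul_of_summable_norm hz.summable.norm hz'.summable.norm
    refine hasSum_of_eq (HasSum.mul hz hz' hm) fun m => ?_
    simp only [F, innerDensity]
    ring
  have key := integrable_and_hasSum_integral (fun m => integrable_innerDensity _ _ _ _) hs hz
  refine ⟨key.1, ?_⟩
  have h0 : HasSum (fun m : ℕ × ℕ => (inner ℂ (g m.1) (p m.2) * inner ℂ (q m.2) (f m.1) : ℂ))
      (∫ z : ℝ × ℝ, k z.1 z.2 * l z.2 z.1) :=
    hasSum_of_eq key.2 fun m => (integral_innerDensity _ _ _ _).trans (mul_comm _ _)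
  have h1 : HasSum (fun n => (inner ℂ (g n) (S (f n)) : ℂ))
      (∫ z : ℝ × ℝ, k z.1 z.2 * l z.2 z.1) :=
    h0.prod_fiberwise fun n => hS.hasSum_inner (g n) (f n)
  have h2 := (hT.mul_right S).hasTrace
  simp only [ContinuousLinearMap.adjoint_inner_left] at h2
  rwa [h1.tsum_eq] at h2

theorem HasNuclearKernel.displacement_conj {T : BoundedOp Mode} {k : ℝ → ℝ → ℂ}
    (hT : HasNuclearKernel T k) (u : Fin 2 → ℝ) :
    HasNuclearKernel (displacement u * T * ContinuousLinearMap.adjoint (displacement u))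
      (fun x y => weylPhase u x * k (x - u 0) (y - u 0) * conj (weylPhase u y)) := by
  obtain ⟨f, g, hT, hk⟩ := hT
  refine ⟨_, _, (hT.mul_left _).mul_right _, ?_⟩
  simp only [ContinuousLinearMap.adjoint_adjoint]
  have h1 : ∀ᵐ p : ℝ × ℝ, ∀ n, wave (displacement u (f n)) p.1 =
      weylPhase u p.1 * wave (f n) (p.1 - u 0) :=
    Measure.quasiMeasurePreserving_fst.ae (ae_all_iff.2 fun n => wave_displacement u (f n))
  have h2 : ∀ᵐ p : ℝ × ℝ, ∀ n, wave (displacement u (g n)) p.2 =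
      weylPhase u p.2 * wave (g n) (p.2 - u 0) :=
    Measure.quasiMeasurePreserving_snd.ae (ae_all_iff.2 fun n => wave_displacement u (g n))
  have h3 : ∀ᵐ p : ℝ × ℝ, HasSum (fun n => wave (f n) (p.1 - u 0) * conj (wave (g n) (p.2 - u 0)))
      (k (p.1 - u 0) (p.2 - u 0)) :=
    ((measurePreserving_sub (u 0)).prod (measurePreserving_sub (u 0))).quasiMeasurePreserving.ae hk
  filter_upwards [h1, h2, h3] with p h1 h2 h3
  refine hasSum_of_eq ((h3.mul_left (weylPhase u p.1)).mul_right (conj (weylPhase u p.2))) fun n => ?_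
  rw [h1, h2, map_mul]
  ring

theorem HasNuclearKernel.smul {T : BoundedOp Mode} {k : ℝ → ℝ → ℂ}
    (hT : HasNuclearKernel T k) (c : ℂ) : HasNuclearKernel (c • T) (fun x y => c * k x y) := by
  obtain ⟨f, g, hT, hk⟩ := hT
  refine ⟨_, _, hT.smul c, ?_⟩
  have h1 : ∀ᵐ p : ℝ × ℝ, ∀ n, wave (c • f n) p.1 = c * wave (f n) p.1 :=
    Measure.quasiMeasurePreserving_fst.ae (ae_all_iff.2 fun n => wave_smul c (f n))
  filter_upwards [h1, hk] with p h1 h2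
  simpa only [h1, mul_assoc] using h2.mul_left c

/-! ### The characteristic function determines the operator -/

/-- The displacement by `(-b, v)`, with its phase split into a constant and a plane wave. -/
theorem wave_shift (b v : ℝ) (φ : Mode) :
    wave (displacement ![-b, v] φ) =ᵐ[volume] fun x =>
      Complex.exp (Complex.I * (b * v / 2)) * (Complex.exp (Complex.I * v * x) * wave φ (x + b)) := by
  filter_upwards [wave_displacement ![-b, v] φ] with x hx
  rw [hx, ← mul_assoc, ← Complex.exp_add]
  simp only [weylPhase, Matrix.cons_val_zero, Matrix.cons_val_one, sub_neg_eq_add]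
  congr 2
  push_cast
  ring

/-- For a trace class operator with kernel `∑ₙ fₙ(x) conj (gₙ(y))`, the characteristic function
along a vertical line is, up to a phase, the Fourier transform of the restriction of the kernel to
a parallel of the diagonal, so that the kernel can be recovered from it. -/
theorem NuclearExpansion.ae_diagonal_eq {T : BoundedOp Mode} {f g : ℕ → Mode}
    (hT : NuclearExpansion T f g) {χ : (Fin 2 → ℝ) → ℂ}
    (hχ : ∀ u, HasTrace (displacement u * T) (χ u)) {b : ℝ} {k : ℝ → ℂ} (hk : Integrable k)
    (hkχ : ∀ v : ℝ, ∫ x : ℝ, Complex.exp (Complex.I * v * x) * k x =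
      Complex.exp (-(Complex.I * (b * v / 2))) * χ ![-b, v]) :
    (fun x => ∑' n, wave (f n) (x + b) * conj (wave (g n) x)) =ᵐ[volume] k := by
  have hF (v : ℝ) (n : ℕ) : (fun x => conj (wave (g n) x) * wave (displacement ![-b, v] (f n)) x)
      =ᵐ[volume] fun x => Complex.exp (Complex.I * (b * v / 2)) *
        (Complex.exp (Complex.I * v * x) * (wave (f n) (x + b) * conj (wave (g n) x))) := by
    filter_upwards [wave_shift b v (f n)] with x hx
    rw [hx]
    ring
  have hs (v : ℝ) : Summable fun n =>
      ∫ x, ‖conj (wave (g n) x) * wave (displacement ![-b, v] (f n)) x‖ := by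
    refine Summable.of_nonneg_of_le (fun n => integral_nonneg fun _ => norm_nonneg _)
      (fun n => integral_norm_mul_le _ _) ?_
    simpa only [norm_displacement, mul_comm] using hT.summable
  have hsum (v : ℝ) : ∀ᵐ x, HasSum
      (fun n => conj (wave (g n) x) * wave (displacement ![-b, v] (f n)) x)
      (Complex.exp (Complex.I * (b * v / 2)) * (Complex.exp (Complex.I * v * x) *
        ∑' n, wave (f n) (x + b) * conj (wave (g n) x))) := by
    filter_upwards [ae_hasSum_tsum (fun n => integrable_conj_mul (g n)
      (displacement ![-b, v] (f n))) (hs v), ae_all_iff.2 (hF v)] with x h1 h2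
    rw [← tsum_mul_left, ← tsum_mul_left]
    simpa only [h2] using h1
  have h3 (v : ℝ) := integrable_and_hasSum_integral (fun n => integrable_conj_mul (g n)
      (displacement ![-b, v] (f n))) (hs v) (hsum v)
  refine ae_eq_of_fourier_eq (by simpa using (h3 0).1) hk fun v => ?_
  have h4 := (h3 v).2
  simp_rw [← inner_eq_integral] at h4
  have h5 := h4.tsum_eq.symm.trans ((hχ ![-b, v]).tsum_eq (hT.mul_left _))
  rw [integral_const_mul] at h5
  rw [hkχ, ← h5, ← mul_assoc, ← Complex.exp_add, neg_add_cancel, Complex.exp_zero, one_mul]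

/-- An operator is determined by its characteristic function: if `T` is trace class and `S` is
a nuclear integral operator with kernel `k`, it suffices to compare the characteristic function of
`T` with the Fourier transforms of `k` along the parallels of the diagonal. -/
theorem eq_of_characteristic {T S : BoundedOp Mode} {f g : ℕ → Mode}
    (hT : NuclearExpansion T f g) {χ : (Fin 2 → ℝ) → ℂ}
    (hχ : ∀ u, HasTrace (displacement u * T) (χ u)) {k : ℝ → ℝ → ℂ} (hS : HasNuclearKernel S k)
    (hk : ∀ b, Integrable fun x => k (x + b) x)
    (hkχ : ∀ b v : ℝ, ∫ x : ℝ, Complex.exp (Complex.I * v * x) * k (x + b) x =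
      Complex.exp (-(Complex.I * (b * v / 2))) * χ ![-b, v]) :
    T = S := by
  ext1 φ
  refine ext_inner_left ℂ fun ψ => ?_
  have h1 := integrable_and_hasSum_integral
    (fun n => integrable_innerDensity ψ (f n) (g n) φ) (hT.summable_integral_norm ψ φ)
    (ae_hasSum_tsum (fun n => integrable_innerDensity ψ (f n) (g n) φ)
      (hT.summable_integral_norm ψ φ))
  simp_rw [integral_innerDensity] at h1
  obtain ⟨h2, h3⟩ := hS.inner_eq ψ φ
  rw [(hT.hasSum_inner ψ φ).unique h1.2, h3]
  -- the shear `(b, y) ↦ (b + y, y)` turns both sides into iterated integrals along diagonals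
  have hm : MeasurePreserving (fun z : ℝ × ℝ => (z.1 + z.2, z.2)) volume volume :=
    measurePreserving_add_prod volume volume
  have he : MeasurableEmbedding (fun z : ℝ × ℝ => (z.1 + z.2, z.2)) :=
    hm.measurable.measurableEmbedding fun z w h => by
      simp only [Prod.mk.injEq] at h
      exact Prod.ext (by linarith) h.2
  rw [← hm.integral_comp he (fun p => ∑' n, innerDensity ψ (f n) (g n) φ p),
    ← hm.integral_comp he (fun p => conj (wave ψ p.1) * k p.1 p.2 * wave φ p.2)]
  have i1 := (hm.integrable_comp_emb he).2 h1.1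
  have i2 := (hm.integrable_comp_emb he).2 h2
  simp only [Function.comp_def] at i1 i2
  rw [Measure.volume_eq_prod] at i1 i2 ⊢
  rw [integral_prod _ i1, integral_prod _ i2]
  congr 1 with b
  refine integral_congr_ae ?_
  filter_upwards [hT.ae_diagonal_eq hχ (hk b) (hkχ b)] with y hy
  simp only [add_comm b y, ← hy, innerDensity]
  rw [← tsum_mul_left, ← tsum_mul_right]
  congr 1 with n
  ring

/-! ### The Mehler kernel -/

/-- A Gaussian integral with real leading coefficient, where the square root is the real one. -/
theorem integral_cexp_real_quadratic {b : ℝ} (hb : 0 < b) (c d : ℂ) :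
    ∫ x : ℝ, Complex.exp (-(b : ℂ) * x ^ 2 + c * x + d) =
      (√(Real.pi / b) : ℝ) * Complex.exp (d + c ^ 2 / (4 * b)) := by
  rw [integral_cexp_quadratic (by simpa using hb)]
  congr 1
  · rw [neg_neg, Real.sqrt_eq_rpow, Complex.ofReal_cpow (by positivity)]
    push_cast
    rfl
  · congr 1
    rw [mul_neg, div_neg, sub_neg_eq_add]

/-- Mercer's construction: a kernel `k (x, y) = ∑ₙ fₙ(x) fₙ(y)` with integrable diagonal is the
kernel of a positive nuclear operator. -/
theorem exists_nonneg_hasNuclearKernel {f : ℕ → ℝ → ℝ} {k : ℝ → ℝ → ℝ}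
    (hf : ∀ n, Continuous (f n)) (hk : ∀ x y, HasSum (fun n => f n x * f n y) (k x y))
    (hi : Integrable fun x => k x x) :
    ∃ T : BoundedOp Mode, 0 ≤ T ∧ HasNuclearKernel T fun x y => (k x y : ℂ) := by
  have hsq : ∀ n, Integrable fun x => f n x * f n x := fun n => by
    refine hi.mono' ((hf n).mul (hf n)).aestronglyMeasurable
      (Filter.Eventually.of_forall fun x => ?_)
    rw [Real.norm_of_nonneg (mul_self_nonneg _)]
    exact le_hasSum (hk x x) n fun m _ => mul_self_nonneg _
  have hm : ∀ n, MemLp (fun x => (f n x : ℂ)) 2 (volume : Measure ℝ) := fun n => by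
    have hc : Continuous fun x => (f n x : ℂ) := Complex.continuous_ofReal.comp (hf n)
    rw [memLp_two_iff_integrable_sq_norm hc.aestronglyMeasurable]
    simpa [sq] using hsq n
  have hn : ∀ n, ‖ofWave _ (hm n)‖ * ‖ofWave _ (hm n)‖ = ∫ x, f n x * f n x := fun n => by
    rw [← sq, ← integral_norm_sq_wave]
    refine integral_congr_ae ?_
    filter_upwards [wave_ofWave (hm n)] with x hx
    rw [hx]
    simp [sq]
  have hs : Summable fun n => ‖ofWave _ (hm n)‖ * ‖ofWave _ (hm n)‖ := by
    refine summable_of_sum_le (c := ∫ x, k x x) (fun n => by positivity) fun u => ?_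
    simp_rw [hn]
    rw [← integral_finsetSum _ fun n _ => hsq n]
    refine integral_mono (integrable_finsetSum _ fun n _ => hsq n) hi fun x => ?_
    exact sum_le_hasSum _ (fun m _ => mul_self_nonneg _) (hk x x)
  obtain ⟨T, hT⟩ := exists_nuclearExpansion _ _ hs
  refine ⟨T, hT.nonneg, _, _, hT, ?_⟩
  have h1 : ∀ᵐ p : ℝ × ℝ, ∀ n, wave (ofWave _ (hm n)) p.1 = f n p.1 :=
    Measure.quasiMeasurePreserving_fst.ae (ae_all_iff.2 fun n => wave_ofWave (hm n))
  have h2 : ∀ᵐ p : ℝ × ℝ, ∀ n, wave (ofWave _ (hm n)) p.2 = f n p.2 :=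
    Measure.quasiMeasurePreserving_snd.ae (ae_all_iff.2 fun n => wave_ofWave (hm n))
  filter_upwards [h1, h2] with p h1 h2
  simp_rw [h1, h2, Complex.conj_ofReal, ← Complex.ofReal_mul]
  exact Complex.hasSum_ofReal.2 (hk p.1 p.2)

/-- The Mehler kernel: the integral kernel of `exp (-t (p̂² + q̂²) / 2)`. -/
noncomputable def mehler (t x y : ℝ) : ℝ :=
  (√(2 * Real.pi * Real.sinh t))⁻¹ *
    Real.exp (-(Real.cosh t * (x ^ 2 + y ^ 2) / 2 - x * y) / Real.sinh t)

theorem sinh_eq_half (t : ℝ) : Real.sinh t = 2 * Real.sinh (t / 2) * Real.cosh (t / 2) := by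
  rw [← Real.sinh_two_mul]; ring_nf

theorem cosh_eq_half (t : ℝ) : Real.cosh t = Real.cosh (t / 2) ^ 2 + Real.sinh (t / 2) ^ 2 := by
  rw [← Real.cosh_two_mul]; ring_nf

theorem tanh_pos {t : ℝ} (ht : 0 < t) : 0 < Real.tanh t := by
  rw [Real.tanh_eq_sinh_div_cosh]
  exact div_pos (Real.sinh_pos_iff.2 ht) (Real.cosh_pos _)

/-- The Mehler kernel in the coordinates `x + y` and `x - y`. -/
theorem mehler_eq {t : ℝ} (ht : 0 < t) (x y : ℝ) :
    mehler t x y = (√(2 * Real.pi * Real.sinh t))⁻¹ *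
      Real.exp (-(Real.tanh (t / 2) * (x + y) ^ 2 + (Real.tanh (t / 2))⁻¹ * (x - y) ^ 2) / 4) := by
  have h1 : 0 < Real.sinh (t / 2) := Real.sinh_pos_iff.2 (by positivity)
  have h2 : 0 < Real.cosh (t / 2) := Real.cosh_pos _
  have h3 : x * y = (Real.cosh (t / 2) ^ 2 - Real.sinh (t / 2) ^ 2) * (x * y) := by
    rw [Real.cosh_sq_sub_sinh_sq, one_mul]
  rw [mehler]
  congr 2
  rw [h3, sinh_eq_half t, cosh_eq_half t, Real.tanh_eq_sinh_div_cosh]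
  field_simp
  ring

theorem exists_mehlerOp {t : ℝ} (ht : 0 < t) :
    ∃ T : BoundedOp Mode, 0 ≤ T ∧ HasNuclearKernel T fun x y => (mehler t x y : ℂ) := by
  have hs : 0 < Real.sinh t := Real.sinh_pos_iff.2 ht
  set c := (√(2 * Real.pi * Real.sinh t))⁻¹ with hc
  have hc0 : 0 ≤ c := by positivity
  -- expand the factor `exp (x y / sinh t)` of the kernel into a power series
  refine exists_nonneg_hasNuclearKernel
    (f := fun n x => √(c / (n.factorial * Real.sinh t ^ n)) *
      (x ^ n * Real.exp (-(Real.cosh t * x ^ 2 / 2) / Real.sinh t)))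
    (fun n => by fun_prop) (fun x y => ?_) ?_
  · have h1 : HasSum (fun n : ℕ => (x * y / Real.sinh t) ^ n / n.factorial)
        (Real.exp (x * y / Real.sinh t)) := by
      rw [Real.exp_eq_exp_ℝ]
      exact NormedSpace.expSeries_div_hasSum_exp _
    have h2 := h1.mul_left (c * (Real.exp (-(Real.cosh t * x ^ 2 / 2) / Real.sinh t) *
      Real.exp (-(Real.cosh t * y ^ 2 / 2) / Real.sinh t)))
    have h3 : mehler t x y = c * (Real.exp (-(Real.cosh t * x ^ 2 / 2) / Real.sinh t) *
      Real.exp (-(Real.cosh t * y ^ 2 / 2) / Real.sinh t)) * Real.exp (x * y / Real.sinh t) := by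
      rw [mehler, ← hc, mul_assoc, ← Real.exp_add, ← Real.exp_add]
      congr 2
      field_simp
      ring
    rw [h3]
    refine hasSum_of_eq h2 fun n => ?_
    have h4 := Real.mul_self_sqrt (show 0 ≤ c / (n.factorial * Real.sinh t ^ n) by positivity)
    calc _ = c / (n.factorial * Real.sinh t ^ n) * (x ^ n * y ^ n) *
          (Real.exp (-(Real.cosh t * x ^ 2 / 2) / Real.sinh t) *
            Real.exp (-(Real.cosh t * y ^ 2 / 2) / Real.sinh t)) := by
          rw [div_pow, mul_pow]
          field_simp
      _ = _ := by
          linear_combination -((x ^ n * y ^ n) *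
            (Real.exp (-(Real.cosh t * x ^ 2 / 2) / Real.sinh t) *
              Real.exp (-(Real.cosh t * y ^ 2 / 2) / Real.sinh t))) * h4
  · have := (integrable_exp_neg_mul_sq (tanh_pos (half_pos ht))).const_mul c
    refine this.congr (Filter.Eventually.of_forall fun x => ?_)
    simp only [mehler_eq ht, hc]
    congr 2
    ring

open Classical in
/-- The operator `exp (-t (p̂² + q̂²) / 2)` for `t > 0` (and `0` otherwise). -/
noncomputable def mehlerOp (t : ℝ) : BoundedOp Mode :=
  if h : 0 < t then (exists_mehlerOp h).choose else 0

theorem mehlerOp_nonneg {t : ℝ} (ht : 0 < t) : 0 ≤ mehlerOp t := by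
  rw [mehlerOp, dif_pos ht]
  exact (exists_mehlerOp ht).choose_spec.1

theorem hasNuclearKernel_mehlerOp {t : ℝ} (ht : 0 < t) :
    HasNuclearKernel (mehlerOp t) fun x y => (mehler t x y : ℂ) := by
  rw [mehlerOp, dif_pos ht]
  exact (exists_mehlerOp ht).choose_spec.2

/-! ### Coherent vectors -/

/-- The wave function `exp (-x² / 2 + b x - b² / 4)` of a coherent vector; with this normalization
the operators `mehlerOp t` only rescale `b`. -/
noncomputable def coherentWave (b : ℂ) (x : ℝ) : ℂ :=
  Complex.exp (-(x : ℂ) ^ 2 / 2 + b * x - b ^ 2 / 4)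

theorem memLp_coherentWave (b : ℂ) : MemLp (coherentWave b) 2 (volume : Measure ℝ) := by
  have hc : Continuous (coherentWave b) := by unfold coherentWave; fun_prop
  rw [memLp_two_iff_integrable_sq_norm hc.aestronglyMeasurable]
  have := (integrable_cexp_quadratic (b := 1) (by simp) (2 * b) (-b ^ 2 / 2)).norm
  refine this.congr (Filter.Eventually.of_forall fun x => ?_)
  simp only [coherentWave]
  rw [← norm_pow, ← Complex.exp_nat_mul]
  congr 2
  push_cast
  ring

/-- The coherent vectors, not normalized: `‖e_b‖² = √π exp (|b|² / 2)`. -/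
noncomputable def coherent (b : ℂ) : Mode := ofWave (coherentWave b) (memLp_coherentWave b)

theorem conj_coherentWave (b : ℂ) (x : ℝ) : conj (coherentWave b x) = coherentWave (conj b) x := by
  simp only [coherentWave, ← Complex.exp_conj]
  simp [map_ofNat]

theorem inner_coherent (w b : ℂ) : (inner ℂ (coherent w) (coherent b) : ℂ) =
    (√Real.pi : ℝ) * Complex.exp (conj w * b / 2) := by
  rw [coherent, inner_ofWave]
  have : ∫ x, conj (coherentWave w x) * wave (coherent b) x =
      ∫ x : ℝ, Complex.exp (-((1 : ℝ) : ℂ) * x ^ 2 + (conj w + b) * x +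
        (-(conj w) ^ 2 / 4 - b ^ 2 / 4)) := by
    refine integral_congr_ae ?_
    filter_upwards [wave_ofWave (memLp_coherentWave b)] with x hx
    rw [coherent, hx, conj_coherentWave, coherentWave, coherentWave, ← Complex.exp_add]
    congr 1
    push_cast
    ring
  rw [this, integral_cexp_real_quadratic one_pos]
  congr 2
  · simp
  · push_cast
    ring

/-- The coherent vectors are total, by injectivity of the Fourier transform. -/
theorem eq_zero_of_inner_coherent {φ : Mode}
    (h : ∀ b, inner ℂ (coherent b) φ = (0 : ℂ)) : φ = 0 := by
  have hi : Integrable fun x => coherentWave 0 x * wave φ x := by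
    exact (memLp_coherentWave 0).integrable_mul (memLp_wave φ)
  have h0 := ae_eq_zero_of_fourier_eq_zero hi fun v => by
    -- up to a constant, the conjugate of `e_{-iv}` is the plane wave `exp (i v x)` times `e_0`
    have h1 := h (-(Complex.I * v))
    rw [coherent, inner_ofWave] at h1
    have h2 : ∀ x : ℝ, Complex.exp (Complex.I * v * x) * (coherentWave 0 x * wave φ x) =
        Complex.exp ((Complex.I * v) ^ 2 / 4) *
          (conj (coherentWave (-(Complex.I * v)) x) * wave φ x) := by
      intro x
      rw [conj_coherentWave, ← mul_assoc, ← mul_assoc]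
      congr 1
      simp only [coherentWave, ← Complex.exp_add]
      congr 1
      simp
      ring
    simp_rw [h2]
    rw [integral_const_mul, h1, mul_zero]
  refine mode_ext ?_
  have hz : wave 0 =ᵐ[volume] 0 := by
    have := Lp.coeFn_zero ℂ 2 (volume : Measure ℝ)
    rw [← map_zero Mode.toLp] at this
    exact this
  filter_upwards [h0, hz] with x hx hz
  rw [hz]
  simpa [coherentWave, Complex.exp_ne_zero] using hx

theorem integral_mehler_mul_coherentWave {t : ℝ} (ht : 0 < t) (b : ℂ) (x : ℝ) :
    ∫ y, (mehler t x y : ℂ) * coherentWave b y =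
      (Real.exp (-t / 2) : ℝ) * coherentWave ((Real.exp (-t) : ℝ) * b) x := by
  have hs : 0 < Real.sinh t := Real.sinh_pos_iff.2 ht
  have he : 0 < Real.exp t := Real.exp_pos t
  have hch : Real.cosh t = (Real.exp t + (Real.exp t)⁻¹) / 2 := by
    rw [Real.cosh_eq, Real.exp_neg]
  have hsh : Real.sinh t = (Real.exp t - (Real.exp t)⁻¹) / 2 := by
    rw [Real.sinh_eq, Real.exp_neg]
  have hB : 0 < Real.exp t / (2 * Real.sinh t) := by positivity
  have h1 : ∀ y : ℝ, (mehler t x y : ℂ) * coherentWave b y =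
      ((√(2 * Real.pi * Real.sinh t))⁻¹ : ℝ) *
        Complex.exp (-((Real.exp t / (2 * Real.sinh t) : ℝ) : ℂ) * y ^ 2 +
          (x / (Real.sinh t : ℝ) + b) * y +
          (-((Real.cosh t : ℝ) * x ^ 2 / (2 * (Real.sinh t : ℝ))) - b ^ 2 / 4)) := by
    intro y
    rw [mehler, coherentWave, Complex.ofReal_mul, mul_assoc, Complex.ofReal_exp, ← Complex.exp_add]
    congr 2
    have hs' : (Real.sinh t : ℂ) ≠ 0 := by exact_mod_cast hs.ne'
    have hcs : (Real.exp t : ℂ) = Real.cosh t + Real.sinh t := by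
      rw [← Complex.ofReal_add, Real.cosh_add_sinh]
    rw [Complex.ofReal_div (Real.exp t), hcs]
    push_cast
    push_cast at hs'
    field_simp
    ring
  simp_rw [h1]
  rw [integral_const_mul, integral_cexp_real_quadratic hB, ← mul_assoc, ← Complex.ofReal_mul]
  congr 2
  · rw [show Real.pi / (Real.exp t / (2 * Real.sinh t)) =
      (2 * Real.pi * Real.sinh t) * Real.exp (-t / 2) ^ 2 by
        rw [← Real.exp_nat_mul, show ((2 : ℕ) : ℝ) * (-t / 2) = -t by push_cast; ring, Real.exp_neg]
        field_simp]
    rw [Real.sqrt_mul (x := 2 * Real.pi * Real.sinh t) (by positivity),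
      Real.sqrt_sq (Real.exp_pos _).le, ← mul_assoc,
      inv_mul_cancel₀ (by positivity), one_mul]
  · rw [hch, Real.exp_neg, hsh]
    rw [hsh] at hs
    set E := Real.exp t
    have hE : (E : ℂ) ≠ 0 := by exact_mod_cast he.ne'
    have hE2 : (E : ℂ) ^ 2 - 1 ≠ 0 := by
      have : E ^ 2 - 1 ≠ 0 := by
        intro h
        rw [show (E - E⁻¹) / 2 = (E ^ 2 - 1) / (2 * E) by field_simp, h] at hs
        simp at hs
      exact_mod_cast this
    have hq : ((E : ℂ) - (E : ℂ)⁻¹) ≠ 0 := by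
      intro h
      apply hE2
      have : (E : ℂ) * (E - (E : ℂ)⁻¹) = 0 := by rw [h, mul_zero]
      rwa [mul_sub, mul_inv_cancel₀ hE, ← sq] at this
    push_cast
    rw [show ((E : ℂ) - (E : ℂ)⁻¹) = (E ^ 2 - 1) / E by field_simp]
    field_simp
    ring

theorem mehlerOp_coherent {t : ℝ} (ht : 0 < t) (b : ℂ) :
    mehlerOp t (coherent b) =
      ((Real.exp (-t / 2) : ℝ) : ℂ) • coherent ((Real.exp (-t) : ℝ) * b) := by
  refine ext_inner_left ℂ fun ψ => ?_
  obtain ⟨h1, h2⟩ := (hasNuclearKernel_mehlerOp ht).inner_eq ψ (coherent b)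
  rw [h2, inner_smul_right, inner_eq_integral, ← integral_const_mul]
  rw [Measure.volume_eq_prod] at h1 ⊢
  rw [integral_prod _ h1]
  refine integral_congr_ae ?_
  filter_upwards [wave_ofWave (memLp_coherentWave ((Real.exp (-t) : ℝ) * b))] with x hx
  rw [coherent, coherent, hx]
  have h3 : ∫ y, conj (wave ψ x) * (mehler t x y : ℂ) * wave (coherent b) y =
      ∫ y, conj (wave ψ x) * ((mehler t x y : ℂ) * coherentWave b y) := by
    refine integral_congr_ae ?_
    filter_upwards [wave_ofWave (memLp_coherentWave b)] with y hy
    rw [coherent, hy, mul_assoc]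
  refine h3.trans ?_
  rw [integral_const_mul, integral_mehler_mul_coherentWave ht]
  ring

/-- The semigroup law, checked on coherent vectors. -/
theorem mehlerOp_add {s t : ℝ} (hs : 0 < s) (ht : 0 < t) :
    mehlerOp (s + t) = mehlerOp s * mehlerOp t := by
  refine ext_of_inner_total (fun _ => eq_zero_of_inner_coherent) fun i j => ?_
  rw [mul_apply_eq_comp, mehlerOp_coherent ht, map_smul, mehlerOp_coherent hs,
    mehlerOp_coherent (add_pos hs ht), smul_smul, ← mul_assoc, ← Complex.ofReal_mul,
    ← Complex.ofReal_mul, ← Real.exp_add, ← Real.exp_add]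
  ring_nf

/-- The powers of the thermal operators `c exp (-β (p̂² + q̂²) / 2)`. -/
theorem smul_mehlerOp_rpow {c β s : ℝ} (hc : 0 < c) (hβ : 0 < β) (hs : 0 < s) :
    ((c : ℂ) • mehlerOp β) ^ s = ((c ^ s : ℝ) : ℂ) • mehlerOp (s * β) := by
  have h := rpow_eq_of_semigroup (e := coherent)
    (N := fun s => ((c ^ s : ℝ) : ℂ) • mehlerOp (s * β))
    (fun _ => eq_zero_of_inner_coherent) (fun t ht => ?_) (fun s t hs ht => ?_) (fun i j => ?_) hs
  · simpa using h
  · have := smul_nonneg (Real.rpow_nonneg hc.le t) (mehlerOp_nonneg (mul_pos ht hβ))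
    simpa using this
  · rw [add_mul, mehlerOp_add (mul_pos hs hβ) (mul_pos ht hβ), Real.rpow_add hc, smul_mul_smul_comm,
      Complex.ofReal_mul]
  · have : ContinuousOn (fun t : ℝ => ((c ^ t : ℝ) : ℂ) * (((Real.exp (-(t * β) / 2) : ℝ) : ℂ) *
        ((√Real.pi : ℝ) * Complex.exp (conj i * ((Real.exp (-(t * β)) : ℝ) * j) / 2)))) (Ioi 0) := by
      have h1 : Continuous fun t : ℝ => c ^ t := Real.continuous_const_rpow hc.ne'
      fun_prop
    refine this.congr fun t ht => ?_
    simp only [_root_.smul_apply]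
    rw [inner_smul_right, mehlerOp_coherent (mul_pos ht hβ), inner_smul_right, inner_coherent]

/-! ### Gaussian integrals of the Mehler kernel -/

theorem thermalGamma_pos {β : ℝ} (hβ : 0 < β) : 0 < thermalGamma β :=
  inv_pos.2 (tanh_pos (half_pos hβ))

/-- The normalization of the thermal state: `2 sinh (t / 2) tr (mehlerOp t) = 1`. -/
theorem sqrt_sinh_tanh {t : ℝ} (ht : 0 < t) :
    (2 * Real.sinh (t / 2)) * (√(2 * Real.pi * Real.sinh t))⁻¹ *
      √(Real.pi / Real.tanh (t / 2)) = 1 := by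
  have h1 : 0 < Real.sinh (t / 2) := Real.sinh_pos_iff.2 (by positivity)
  have h2 : 0 < Real.cosh (t / 2) := Real.cosh_pos _
  have h3 : 2 * Real.pi * Real.sinh t =
      (Real.pi / Real.tanh (t / 2)) * (2 * Real.sinh (t / 2)) ^ 2 := by
    rw [sinh_eq_half t, Real.tanh_eq_sinh_div_cosh]
    field_simp
  have h4 : 0 < Real.pi / Real.tanh (t / 2) := div_pos Real.pi_pos (tanh_pos (half_pos ht))
  rw [h3, Real.sqrt_mul h4.le, Real.sqrt_sq (by positivity)]
  have := (Real.sqrt_pos.2 h4).ne'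
  field_simp

theorem ofReal_mehler {t : ℝ} (ht : 0 < t) (x y : ℝ) :
    (mehler t x y : ℂ) = ((√(2 * Real.pi * Real.sinh t))⁻¹ : ℝ) * Complex.exp
      ((-(Real.tanh (t / 2) * (x + y) ^ 2 + (Real.tanh (t / 2))⁻¹ * (x - y) ^ 2) / 4 : ℝ) : ℂ) := by
  rw [mehler_eq ht, Complex.ofReal_mul, Complex.ofReal_exp]

/-- The characteristic function of the thermal operator `2 sinh (t / 2) mehlerOp t`, as the Fourier
transform of the kernel along the parallels of the diagonal. -/
theorem integral_mehler_diagonal {t : ℝ} (ht : 0 < t) (b v : ℝ) :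
    ∫ x : ℝ, Complex.exp (Complex.I * v * x) *
        ((2 * Real.sinh (t / 2) : ℝ) * (mehler t (x + b) x : ℂ)) =
      Complex.exp (-(Complex.I * (b * v / 2))) *
        Complex.exp (-((thermalGamma t / 4 * (b ^ 2 + v ^ 2) : ℝ) : ℂ)) := by
  have hT := tanh_pos (half_pos ht)
  set T := Real.tanh (t / 2) with hTdef
  have h1 : ∀ x : ℝ, Complex.exp (Complex.I * v * x) *
        ((2 * Real.sinh (t / 2) : ℝ) * (mehler t (x + b) x : ℂ)) =
      ((2 * Real.sinh (t / 2) * (√(2 * Real.pi * Real.sinh t))⁻¹ : ℝ) : ℂ) *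
        Complex.exp (-(T : ℂ) * x ^ 2 + (Complex.I * v - T * b) * x +
          (-(T * b ^ 2 / 4) - b ^ 2 / (4 * T))) := by
    intro x
    have (p q A B : ℂ) : Complex.exp A * (p * (q * Complex.exp B)) =
        p * q * Complex.exp (A + B) := by
      rw [Complex.exp_add]
      ring
    rw [ofReal_mehler ht, ← hTdef, this, ← Complex.ofReal_mul]
    congr 2
    push_cast
    ring
  simp_rw [h1]
  rw [integral_const_mul, integral_cexp_real_quadratic hT, ← mul_assoc, ← Complex.ofReal_mul,
    sqrt_sinh_tanh ht, Complex.ofReal_one, one_mul, ← Complex.exp_add, thermalGamma, ← hTdef]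
  congr 1
  have hT' : (T : ℂ) ≠ 0 := by exact_mod_cast hT.ne'
  push_cast
  field_simp
  ring_nf
  simp only [Complex.I_sq]
  ring

theorem integrable_mehler_diagonal {t : ℝ} (ht : 0 < t) (b : ℝ) :
    Integrable fun x : ℝ => (mehler t (x + b) x : ℂ) := by
  have hT := tanh_pos (half_pos ht)
  have h := (integrable_cexp_quadratic (b := ((Real.tanh (t / 2) : ℝ) : ℂ))
    (by rwa [Complex.ofReal_re]) (-(Real.tanh (t / 2) * b : ℝ))
    (-(Real.tanh (t / 2) * b ^ 2 / 4 + (Real.tanh (t / 2))⁻¹ * b ^ 2 / 4 : ℝ))).const_mul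
      (((√(2 * Real.pi * Real.sinh t))⁻¹ : ℝ) : ℂ)
  refine h.congr (Filter.Eventually.of_forall fun x => ?_)
  simp only
  rw [ofReal_mehler ht]
  congr 2
  push_cast
  ring

/-- The thermal state is determined by its characteristic function. -/
theorem eq_smul_mehlerOp {β : ℝ} (hβ : 0 < β) {τ : BoundedOp Mode} {f g : ℕ → Mode}
    (hτ : NuclearExpansion τ f g)
    (hχ : ∀ u : Fin 2 → ℝ, HasTrace (displacement u * τ)
      (Complex.exp (-((thermalGamma β / 4 * (u 0 ^ 2 + u 1 ^ 2) : ℝ) : ℂ)))) :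
    τ = ((2 * Real.sinh (β / 2) : ℝ) : ℂ) • mehlerOp β := by
  refine eq_of_characteristic hτ hχ ((hasNuclearKernel_mehlerOp hβ).smul _)
    (fun b => (integrable_mehler_diagonal hβ b).const_mul _) fun b v => ?_
  rw [integral_mehler_diagonal hβ]
  simp

/-- `γ_a + γ_b = sinh ((a + b) / 2) / (sinh (a / 2) sinh (b / 2))`. -/
theorem thermalGamma_add {a b : ℝ} (ha : 0 < a) (hb : 0 < b) :
    thermalGamma a + thermalGamma b =
      Real.sinh ((a + b) / 2) / (Real.sinh (a / 2) * Real.sinh (b / 2)) := by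
  have h1 : 0 < Real.sinh (a / 2) := Real.sinh_pos_iff.2 (by positivity)
  have h2 : 0 < Real.sinh (b / 2) := Real.sinh_pos_iff.2 (by positivity)
  rw [thermalGamma, thermalGamma, Real.tanh_eq_sinh_div_cosh, Real.tanh_eq_sinh_div_cosh, add_div,
    Real.sinh_add]
  field_simp
  ring

/-- The prefactors of the two Gaussian integrals in the overlap of two thermal operators combine to
the trace `1 / (2 sinh ((a + b) / 2))` of `mehlerOp (a + b)`. -/
theorem mehler_trace_prefactor {a b : ℝ} (ha : 0 < a) (hb : 0 < b) :
    (√(2 * Real.pi * Real.sinh a))⁻¹ * (√(2 * Real.pi * Real.sinh b))⁻¹ *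
      √(Real.pi / (Real.tanh (a / 2) + Real.tanh (b / 2))) *
      √(Real.pi / ((thermalGamma a + thermalGamma b) / 4)) =
    (2 * Real.sinh ((a + b) / 2))⁻¹ := by
  have h1 : 0 < Real.sinh (a / 2) := Real.sinh_pos_iff.2 (by positivity)
  have h2 : 0 < Real.sinh (b / 2) := Real.sinh_pos_iff.2 (by positivity)
  have h3 : 0 < Real.cosh (a / 2) := Real.cosh_pos _
  have h4 : 0 < Real.cosh (b / 2) := Real.cosh_pos _
  have h5 : 0 < Real.sinh ((a + b) / 2) := Real.sinh_pos_iff.2 (by positivity)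
  have h6 : Real.tanh (a / 2) + Real.tanh (b / 2) =
      Real.sinh ((a + b) / 2) / (Real.cosh (a / 2) * Real.cosh (b / 2)) := by
    rw [Real.tanh_eq_sinh_div_cosh, Real.tanh_eq_sinh_div_cosh, add_div, Real.sinh_add]
    field_simp
  rw [h6, thermalGamma_add ha hb, sinh_eq_half a, sinh_eq_half b, ← Real.sqrt_inv, ← Real.sqrt_inv,
    ← Real.sqrt_mul (by positivity), ← Real.sqrt_mul (by positivity),
    ← Real.sqrt_mul (by positivity), ← Real.sqrt_sq (show 0 ≤ (2 * Real.sinh ((a + b) / 2))⁻¹ by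
      positivity)]
  congr 1
  field_simp
  norm_num

/-- The Gaussian integral giving the overlap of a thermal operator and a displaced one. -/
theorem integral_mehler_mul_displaced {a b : ℝ} (ha : 0 < a) (hb : 0 < b) (δ : Fin 2 → ℝ)
    (hi : Integrable fun p : ℝ × ℝ => (mehler a p.1 p.2 : ℂ) *
      (weylPhase δ p.2 * (mehler b (p.2 - δ 0) (p.1 - δ 0) : ℂ) * conj (weylPhase δ p.1))) :
    ∫ p : ℝ × ℝ, (mehler a p.1 p.2 : ℂ) *
      (weylPhase δ p.2 * (mehler b (p.2 - δ 0) (p.1 - δ 0) : ℂ) * conj (weylPhase δ p.1)) =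
    (((2 * Real.sinh ((a + b) / 2))⁻¹ *
      Real.exp (-((thermalGamma a + thermalGamma b)⁻¹ * (δ 0 ^ 2 + δ 1 ^ 2))) : ℝ) : ℂ) := by
  have hTa := tanh_pos (half_pos ha)
  have hTb := tanh_pos (half_pos hb)
  have hpre := mehler_trace_prefactor ha hb
  have hγ := add_pos (thermalGamma_pos ha) (thermalGamma_pos hb)
  simp only [thermalGamma] at hpre hγ ⊢
  set S := Real.tanh (a / 2) with hS
  set T := Real.tanh (b / 2) with hT
  have hS' : (S : ℂ) ≠ 0 := by exact_mod_cast hTa.ne'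
  have hT' : (T : ℂ) ≠ 0 := by exact_mod_cast hTb.ne'
  have hST' : (S : ℂ) + T ≠ 0 := by exact_mod_cast (add_pos hTa hTb).ne'
  set C := (√(2 * Real.pi * Real.sinh a))⁻¹ * (√(2 * Real.pi * Real.sinh b))⁻¹ with hC
  have h1 : ∀ y z : ℝ, (mehler a (z + y) y : ℂ) *
      (weylPhase δ y * (mehler b (y - δ 0) (z + y - δ 0) : ℂ) * conj (weylPhase δ (z + y))) =
      (C : ℂ) * Complex.exp (-((S + T : ℝ) : ℂ) * y ^ 2 + (-(S * z + T * (z - 2 * δ 0))) * y +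
        (-(S * z ^ 2 + T * (z - 2 * δ 0) ^ 2) / 4 - (S⁻¹ + T⁻¹) * z ^ 2 / 4
          - Complex.I * δ 1 * z)) := by
    intro y z
    rw [ofReal_mehler ha, ofReal_mehler hb, ← hS, ← hT, weylPhase, weylPhase, ← Complex.exp_conj,
      hC, Complex.ofReal_mul]
    have (p q A B D E : ℂ) : p * Complex.exp A * (Complex.exp B * (q * Complex.exp D) *
        Complex.exp E) = p * q * Complex.exp (A + B + D + E) := by
      simp only [Complex.exp_add]
      ring
    rw [this]
    congr 2
    simp only [map_mul, Complex.conj_I, Complex.conj_ofReal]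
    push_cast
    ring
  -- with `(x, y) = (z + y, y)`, the integral over `y` depends on `z` only through a Gaussian
  have hm : MeasurePreserving (fun z : ℝ × ℝ => (z.1 + z.2, z.2)) volume volume :=
    measurePreserving_add_prod volume volume
  have he : MeasurableEmbedding (fun z : ℝ × ℝ => (z.1 + z.2, z.2)) :=
    hm.measurable.measurableEmbedding fun z w h => by
      simp only [Prod.mk.injEq] at h
      exact Prod.ext (by linarith) h.2
  rw [← hm.integral_comp he (fun p : ℝ × ℝ => (mehler a p.1 p.2 : ℂ) *
      (weylPhase δ p.2 * (mehler b (p.2 - δ 0) (p.1 - δ 0) : ℂ) * conj (weylPhase δ p.1)))]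
  have i1 := (hm.integrable_comp_emb he).2 hi
  simp only [Function.comp_def] at i1
  rw [Measure.volume_eq_prod] at i1 ⊢
  rw [integral_prod _ i1]
  simp only [h1]
  have h2 : ∀ z : ℝ, ∫ y : ℝ, (C : ℂ) * Complex.exp (-((S + T : ℝ) : ℂ) * y ^ 2 +
      (-(S * z + T * (z - 2 * δ 0))) * y + (-(S * z ^ 2 + T * (z - 2 * δ 0) ^ 2) / 4
        - (S⁻¹ + T⁻¹) * z ^ 2 / 4 - Complex.I * δ 1 * z)) =
      ((C * √(Real.pi / (S + T)) : ℝ) : ℂ) *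
        Complex.exp (-(((S⁻¹ + T⁻¹) / 4 : ℝ) : ℂ) * z ^ 2 + (-(Complex.I * δ 1)) * z +
          (-((S⁻¹ + T⁻¹)⁻¹ * δ 0 ^ 2 : ℝ))) := by
    intro z
    rw [integral_const_mul, integral_cexp_real_quadratic (add_pos hTa hTb), ← mul_assoc,
      ← Complex.ofReal_mul]
    congr 2
    push_cast
    rw [show ((S : ℂ)⁻¹ + (T : ℂ)⁻¹) = (S + T) / (S * T) by field_simp; ring]
    field_simp
    ring
  simp only [h2]
  rw [integral_const_mul, integral_cexp_real_quadratic (by positivity), ← mul_assoc,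
    ← Complex.ofReal_mul, hpre, Complex.ofReal_mul (2 * Real.sinh ((a + b) / 2))⁻¹,
    Complex.ofReal_exp]
  congr 2
  have hγ' : (S : ℂ)⁻¹ + (T : ℂ)⁻¹ ≠ 0 := by exact_mod_cast hγ.ne'
  push_cast
  generalize (S : ℂ)⁻¹ + (T : ℂ)⁻¹ = G at hγ'
  field_simp
  ring_nf
  simp only [Complex.I_sq]
  ring

/-- The overlap of two displaced thermal operators. -/
theorem hasTrace_mehlerOp_mul_displaced {a b : ℝ} (ha : 0 < a) (hb : 0 < b) (δ : Fin 2 → ℝ) :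
    HasTrace (mehlerOp a * (displacement δ * mehlerOp b *
        ContinuousLinearMap.adjoint (displacement δ)))
      (((2 * Real.sinh ((a + b) / 2))⁻¹ *
        Real.exp (-((thermalGamma a + thermalGamma b)⁻¹ * (δ 0 ^ 2 + δ 1 ^ 2))) : ℝ) : ℂ) := by
  have h := (hasNuclearKernel_mehlerOp ha).hasTrace_mul
    ((hasNuclearKernel_mehlerOp hb).displacement_conj δ)
  rw [integral_mehler_mul_displaced ha hb δ h.1] at h
  exact h.2

/-! ### Squeezing operators -/

theorem ae_const_mul {p : ℝ → Prop} {c : ℝ} (hc : c ≠ 0) (h : ∀ᵐ x, p x) :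
    ∀ᵐ x : ℝ, p (c * x) := by
  have : Measure.QuasiMeasurePreserving (fun x : ℝ => c * x) volume volume :=
    ⟨by fun_prop, by
      rw [Real.map_volume_mul_left hc]
      exact Measure.smul_absolutelyContinuous⟩
  exact this.ae h

/-- The wave function `a^{-1/2} exp (i k x² / 2) f (x / a)`. -/
noncomputable def squeezeWave (a k : ℝ) (f : ℝ → ℂ) (x : ℝ) : ℂ :=
  ((√a)⁻¹ : ℝ) * Complex.exp (Complex.I * ((k * x ^ 2 / 2 : ℝ) : ℂ)) * f (a⁻¹ * x)

theorem norm_sq_squeezeWave {a : ℝ} (ha : 0 < a) (k : ℝ) (f : ℝ → ℂ) (x : ℝ) :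
    ‖squeezeWave a k f x‖ ^ 2 = a⁻¹ * ‖f (a⁻¹ * x)‖ ^ 2 := by
  rw [squeezeWave, norm_mul, norm_mul, mul_comm Complex.I, Complex.norm_exp_ofReal_mul_I, mul_one,
    mul_pow, Complex.norm_real, Real.norm_of_nonneg (by positivity), inv_pow, Real.sq_sqrt ha.le]

theorem memLp_squeezeWave {a : ℝ} (ha : 0 < a) (k : ℝ) (φ : Mode) :
    MemLp (squeezeWave a k (wave φ)) 2 (volume : Measure ℝ) := by
  have hm : AEStronglyMeasurable (fun x => wave φ (a⁻¹ * x)) (volume : Measure ℝ) := by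
    refine (memLp_wave φ).1.comp_quasiMeasurePreserving ⟨by fun_prop, ?_⟩
    rw [Real.map_volume_mul_left (inv_ne_zero ha.ne')]
    exact Measure.smul_absolutelyContinuous
  have hc : Continuous fun x : ℝ =>
      (((√a)⁻¹ : ℝ) : ℂ) * Complex.exp (Complex.I * ((k * x ^ 2 / 2 : ℝ) : ℂ)) := by fun_prop
  have hm' : AEStronglyMeasurable (squeezeWave a k (wave φ)) (volume : Measure ℝ) :=
    hc.aestronglyMeasurable.mul hm
  rw [memLp_two_iff_integrable_sq_norm hm']
  simp_rw [norm_sq_squeezeWave ha]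
  have := (memLp_two_iff_integrable_sq_norm (memLp_wave φ).1).1 (memLp_wave φ)
  exact (this.comp_mul_left' (inv_ne_zero ha.ne')).const_mul _

theorem wave_add (φ ψ : Mode) : wave (φ + ψ) =ᵐ[volume] fun x => wave φ x + wave ψ x := by
  have h := Lp.coeFn_add (Mode.toLp φ) (Mode.toLp ψ)
  rw [← map_add] at h
  exact h

/-- The unitary operator `f ↦ a^{-1/2} exp (i k x² / 2) f (x / a)`, which implements the symplectic
transformation with matrix `!![a, 0; k a, a⁻¹]`. -/
noncomputable def squeezeIsometry {a : ℝ} (ha : 0 < a) (k : ℝ) : Mode →ₗᵢ[ℂ] Mode where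
  toFun φ := ofWave _ (memLp_squeezeWave ha k φ)
  map_add' φ ψ := by
    refine mode_ext ?_
    filter_upwards [wave_ofWave (memLp_squeezeWave ha k (φ + ψ)),
      wave_ofWave (memLp_squeezeWave ha k φ), wave_ofWave (memLp_squeezeWave ha k ψ),
      wave_add (ofWave _ (memLp_squeezeWave ha k φ)) (ofWave _ (memLp_squeezeWave ha k ψ)),
      ae_const_mul (inv_ne_zero ha.ne') (wave_add φ ψ)] with x h1 h2 h3 h4 h5
    rw [h1, h4, h2, h3]
    simp only [squeezeWave, h5]
    ring
  map_smul' c φ := by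
    refine mode_ext ?_
    filter_upwards [wave_ofWave (memLp_squeezeWave ha k (c • φ)),
      wave_ofWave (memLp_squeezeWave ha k φ),
      wave_smul c (ofWave _ (memLp_squeezeWave ha k φ)),
      ae_const_mul (inv_ne_zero ha.ne') (wave_smul c φ)] with x h1 h2 h3 h4
    rw [RingHom.id_apply, h1, h3, h2]
    simp only [squeezeWave, h4]
    ring
  norm_map' φ := by
    change ‖ofWave _ (memLp_squeezeWave ha k φ)‖ = ‖φ‖
    rw [← sq_eq_sq₀ (norm_nonneg _) (norm_nonneg _), ← integral_norm_sq_wave,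
      ← integral_norm_sq_wave]
    have h : ∫ x, ‖wave (ofWave _ (memLp_squeezeWave ha k φ)) x‖ ^ 2 =
        ∫ x, a⁻¹ * ‖wave φ (a⁻¹ * x)‖ ^ 2 := by
      refine integral_congr_ae ?_
      filter_upwards [wave_ofWave (memLp_squeezeWave ha k φ)] with x hx
      rw [hx, norm_sq_squeezeWave ha]
    rw [h, integral_const_mul, Measure.integral_comp_mul_left (fun x => ‖wave φ x‖ ^ 2), inv_inv,
      abs_of_pos ha, smul_eq_mul, ← mul_assoc, inv_mul_cancel₀ ha.ne', one_mul]

/-- The operator `squeezeIsometry` as a bounded operator. -/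
noncomputable def squeezeOp {a : ℝ} (ha : 0 < a) (k : ℝ) : BoundedOp Mode :=
  (squeezeIsometry ha k).toContinuousLinearMap

theorem wave_squeezeOp {a : ℝ} (ha : 0 < a) (k : ℝ) (φ : Mode) :
    wave (squeezeOp ha k φ) =ᵐ[volume] squeezeWave a k (wave φ) :=
  wave_ofWave (memLp_squeezeWave ha k φ)

/-- `squeezeOp` is surjective, with an operator of the same form as inverse. -/
theorem squeezeOp_mul_inv {a : ℝ} (ha : 0 < a) (k : ℝ) :
    squeezeOp ha k * squeezeOp (inv_pos.2 ha) (-(k * a ^ 2)) = 1 := by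
  ext φ
  refine mode_ext ?_
  filter_upwards [wave_squeezeOp ha k (squeezeOp (inv_pos.2 ha) (-(k * a ^ 2)) φ),
    ae_const_mul (inv_ne_zero ha.ne') (wave_squeezeOp (inv_pos.2 ha) (-(k * a ^ 2)) φ)] with x h1 h2
  refine h1.trans ?_
  rw [squeezeWave, h2, squeezeWave, inv_inv, mul_inv_cancel_left₀ ha.ne', one_apply_eq_self]
  have h3 : (k * x ^ 2 / 2 : ℝ) + (-(k * a ^ 2) * (a⁻¹ * x) ^ 2 / 2 : ℝ) = 0 := by
    field_simp
    ring
  have h4 : (√a)⁻¹ * (√a⁻¹)⁻¹ = 1 := by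
    rw [Real.sqrt_inv, inv_inv, inv_mul_cancel₀ (Real.sqrt_pos.2 ha).ne']
  calc _ = (((√a)⁻¹ * (√a⁻¹)⁻¹ : ℝ) : ℂ) * Complex.exp (Complex.I *
        (((k * x ^ 2 / 2 : ℝ) + (-(k * a ^ 2) * (a⁻¹ * x) ^ 2 / 2 : ℝ) : ℝ) : ℂ)) * wave φ x := by
        rw [Complex.ofReal_add, mul_add, Complex.exp_add, Complex.ofReal_mul]
        ring
    _ = _ := by rw [h3, h4]; simp

theorem adjoint_mul_self_of_norm {V : BoundedOp Mode} (hV : ∀ φ, ‖V φ‖ = ‖φ‖) :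
    ContinuousLinearMap.adjoint V * V = 1 :=
  (ContinuousLinearMap.norm_map_iff_adjoint_comp_self V).1 hV

theorem squeezeOp_mem_unitary {a : ℝ} (ha : 0 < a) (k : ℝ) :
    squeezeOp ha k ∈ unitary (BoundedOp Mode) := by
  have h1 : star (squeezeOp ha k) * squeezeOp ha k = 1 :=
    adjoint_mul_self_of_norm fun φ => (squeezeIsometry ha k).norm_map φ
  have h2 := squeezeOp_mul_inv ha k
  refine ⟨h1, ?_⟩
  rwa [left_inv_eq_right_inv h1 h2]

theorem displacement_mem_unitary (u : Fin 2 → ℝ) : displacement u ∈ unitary (BoundedOp Mode) := by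
  rw [Unitary.mem_iff, ContinuousLinearMap.star_eq_adjoint, adjoint_displacement]
  exact ⟨displacement_neg_mul u, displacement_mul_neg u⟩

/-- Squeezing intertwines displacements by a symplectic transformation. -/
theorem squeezeOp_mul_displacement {a : ℝ} (ha : 0 < a) (k : ℝ) (u : Fin 2 → ℝ) :
    squeezeOp ha k * displacement u =
      displacement ![a * u 0, k * a * u 0 + a⁻¹ * u 1] * squeezeOp ha k := by
  ext φ
  refine mode_ext ?_
  filter_upwards [wave_squeezeOp ha k (displacement u φ),
    ae_const_mul (inv_ne_zero ha.ne') (wave_displacement u φ),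
    wave_displacement ![a * u 0, k * a * u 0 + a⁻¹ * u 1] (squeezeOp ha k φ),
    ae_sub_const (a * u 0) (wave_squeezeOp ha k φ)] with x h1 h2 h3 h4
  refine h1.trans (Eq.trans ?_ h3.symm)
  simp only [Matrix.cons_val_zero]
  rw [h4, squeezeWave, squeezeWave, h2, weylPhase, weylPhase]
  simp only [Matrix.cons_val_zero, Matrix.cons_val_one]
  have h (r z A B D E : ℂ) (hE : A + B = D + E) : r * Complex.exp A * (Complex.exp B * z) =
      Complex.exp D * (r * Complex.exp E * z) := by
    calc _ = r * z * Complex.exp (A + B) := by rw [Complex.exp_add]; ring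
      _ = _ := by rw [hE, Complex.exp_add]; ring
  rw [mul_sub, inv_mul_cancel_left₀ ha.ne']
  refine h _ _ _ _ _ _ ?_
  have ha' : (a : ℂ) ≠ 0 := by exact_mod_cast ha.ne'
  push_cast
  field_simp
  ring

/-! ### Reduction to the thermal state -/

theorem HasTrace.smul {T : BoundedOp Mode} {t : ℂ} (h : HasTrace T t) (c : ℂ) :
    HasTrace (c • T) (c * t) := by
  obtain ⟨f, g, hT⟩ := h.exists_nuclearExpansion
  have h1 := (hT.smul c).hasTrace
  simp only [inner_smul_right] at h1
  rwa [tsum_mul_left, h.tsum_eq hT] at h1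

/-- The linear symplectic map with matrix `!![a, 0; k a, a⁻¹]`. -/
noncomputable def shearMap (a k : ℝ) (u : Fin 2 → ℝ) : Fin 2 → ℝ :=
  ![a * u 0, k * a * u 0 + a⁻¹ * u 1]

/-- The Gaussian unitary `D(ξ) U` intertwines displacements by a symplectic map, up to a phase. -/
theorem gaussianUnitary_mul_displacement {a : ℝ} (ha : 0 < a) (k : ℝ) (ξ u : Fin 2 → ℝ) :
    (displacement ξ * squeezeOp ha k) * displacement u =
      Complex.exp (Complex.I * ((ξ 1 * shearMap a k u 0 - ξ 0 * shearMap a k u 1 : ℝ) : ℂ)) •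
        (displacement (shearMap a k u) * (displacement ξ * squeezeOp ha k)) := by
  rw [mul_assoc, squeezeOp_mul_displacement, ← mul_assoc, ← mul_assoc,
    ← smul_mul_assoc]
  congr 1
  exact displacement_comm ξ _

/-- A Gaussian state with covariance matrix `γ_β A`, where `A` is symmetric and positive with
determinant one, is unitarily equivalent to the thermal state, by a Gaussian unitary obtained from
the Cholesky factorization of `A`. -/
theorem IsGaussianState.eq_conj {β : ℝ} (hβ : 0 < β) {A : Matrix (Fin 2) (Fin 2) ℝ}
    (hA : A 1 0 = A 0 1) (hA0 : 0 < A 0 0) (hdet : A 0 0 * A 1 1 - A 0 1 ^ 2 = 1)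
    {ξ : Fin 2 → ℝ} {ρ : BoundedOp Mode} (hρ : IsGaussianState ρ ξ (thermalGamma β • A)) :
    let V := displacement ξ * squeezeOp (Real.sqrt_pos.2 hA0) (A 0 1 / A 0 0)
    ρ = V * (((2 * Real.sinh (β / 2) : ℝ) : ℂ) • mehlerOp β) * star V := by
  intro V
  have hV : V ∈ unitary (BoundedOp Mode) :=
    mul_mem (displacement_mem_unitary ξ) (squeezeOp_mem_unitary _ _)
  obtain ⟨hV1, hV2⟩ := Unitary.mem_iff.1 hV
  obtain ⟨f, g, hfg⟩ := hρ.1.2.exists_nuclearExpansion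
  have hτ := (hfg.mul_left (star V)).mul_right V
  have key : star V * ρ * V = ((2 * Real.sinh (β / 2) : ℝ) : ℂ) • mehlerOp β := by
    refine eq_smul_mehlerOp hβ hτ fun u => ?_
    set v := shearMap (√(A 0 0)) (A 0 1 / A 0 0) u with hv
    -- `tr (D(u) V† ρ V)` is `tr (D(v) ρ)` up to a phase, which cancels the one due to `ξ`
    have h1 : V * displacement u = Complex.exp (Complex.I * ((ξ 1 * v 0 - ξ 0 * v 1 : ℝ) : ℂ)) •
        (displacement v * V) := gaussianUnitary_mul_displacement _ _ _ _
    have h2 : displacement u * (star V * ρ * V) =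
        Complex.exp (Complex.I * ((ξ 1 * v 0 - ξ 0 * v 1 : ℝ) : ℂ)) •
          (star V * (displacement v * ρ) * ContinuousLinearMap.adjoint (star V)) := by
      calc _ = star V * (V * displacement u) * (star V * ρ * V) := by
            rw [← mul_assoc (star V) V, hV1, one_mul]
        _ = Complex.exp (Complex.I * ((ξ 1 * v 0 - ξ 0 * v 1 : ℝ) : ℂ)) •
            (star V * displacement v * (V * star V) * ρ * V) := by
          rw [h1, mul_smul_comm, smul_mul_assoc]
          simp only [mul_assoc]
        _ = _ := by
          rw [hV2, mul_one, ← ContinuousLinearMap.star_eq_adjoint, star_star]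
          simp only [mul_assoc]
    have h3 := ((hρ.2 v).conj (V := star V)
      (by rw [← ContinuousLinearMap.star_eq_adjoint, star_star, hV2])).smul
        (Complex.exp (Complex.I * ((ξ 1 * v 0 - ξ 0 * v 1 : ℝ) : ℂ)))
    rw [h2]
    convert h3 using 1
    rw [← Complex.exp_add]
    congr 1
    -- `A` is the Cholesky product of the matrix of `shearMap`, so the quadratic form is `γ |u|²`
    have hq : v ⬝ᵥ ((symplecticFormᵀ * (thermalGamma β • A) * symplecticForm) *ᵥ v) =
        thermalGamma β * (u 0 ^ 2 + u 1 ^ 2) := by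
      have hsq : √(A 0 0) ^ 2 = A 0 0 := Real.sq_sqrt hA0.le
      have hs0 : √(A 0 0) ≠ 0 := (Real.sqrt_pos.2 hA0).ne'
      have hw : A 1 1 = (1 + A 0 1 ^ 2) / √(A 0 0) ^ 2 := by
        rw [hsq]
        field_simp
        linarith
      simp only [hv, shearMap, symplecticForm, Matrix.mulVec, dotProduct, Matrix.mul_apply,
        Fin.sum_univ_two, Matrix.transpose_apply, Matrix.smul_apply, smul_eq_mul,
        Matrix.of_apply, Matrix.cons_val', Matrix.cons_val_zero, Matrix.cons_val_one,
        Matrix.cons_val_fin_one, hA, hw]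
      generalize √(A 0 0) = a at hsq hs0 ⊢
      rw [← hsq]
      field_simp
      ring
    have hl : v ⬝ᵥ (symplecticForm *ᵥ ξ) = v 0 * ξ 1 - v 1 * ξ 0 := by
      simp [symplecticForm, Matrix.mulVec, dotProduct, Fin.sum_univ_two]
      ring
    rw [hq, hl]
    push_cast
    ring
  rw [← key]
  calc ρ = (V * star V) * ρ * (V * star V) := by rw [hV2, one_mul, mul_one]
    _ = _ := by simp only [mul_assoc]

/-- The overlaps `tr (ρ₀ ^ s ρ₁ ^ (1 - s))` of a Gaussian state and its displacement. -/
theorem hasTrace_rpow_mul_rpow {β : ℝ} (hβ : 0 < β) {A : Matrix (Fin 2) (Fin 2) ℝ}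
    (hA : A 1 0 = A 0 1) (hA0 : 0 < A 0 0) (hdet : A 0 0 * A 1 1 - A 0 1 ^ 2 = 1)
    {ξ δ : Fin 2 → ℝ} {ρ₀ ρ₁ : BoundedOp Mode}
    (hρ₀ : IsGaussianState ρ₀ ξ (thermalGamma β • A))
    (hρ₁ : ρ₁ = displacement δ * ρ₀ * ContinuousLinearMap.adjoint (displacement δ))
    {s : ℝ} (hs : s ∈ Ioo (0 : ℝ) 1) :
    HasTrace (ρ₀ ^ s * ρ₁ ^ (1 - s))
      (Real.exp (-((thermalGamma (s * β) + thermalGamma ((1 - s) * β))⁻¹ *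
        (A 1 1 * δ 0 ^ 2 - 2 * A 0 1 * δ 0 * δ 1 + A 0 0 * δ 1 ^ 2))) : ℝ) := by
  have hs1 : 0 < 1 - s := sub_pos.2 hs.2
  have h0 := hρ₀.eq_conj hβ hA hA0 hdet
  set a := √(A 0 0) with ha_def
  have ha : 0 < a := Real.sqrt_pos.2 hA0
  have hsq : a ^ 2 = A 0 0 := Real.sq_sqrt hA0.le
  set k := A 0 1 / A 0 0 with hk
  simp only at h0
  set V := displacement ξ * squeezeOp ha k with hV_def
  set c := 2 * Real.sinh (β / 2) with hc_def
  have hc : 0 < c := mul_pos two_pos (Real.sinh_pos_iff.2 (half_pos hβ))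
  have hV : V ∈ unitary (BoundedOp Mode) :=
    mul_mem (displacement_mem_unitary ξ) (squeezeOp_mem_unitary _ _)
  obtain ⟨hV1, hV2⟩ := Unitary.mem_iff.1 hV
  -- the displacement by `δ` becomes the displacement of the thermal state by `η`
  let η : Fin 2 → ℝ := ![a⁻¹ * δ 0, a * (δ 1 - k * δ 0)]
  have hη : shearMap a k η = δ := by
    ext i
    fin_cases i
    · simp [shearMap, η, mul_inv_cancel_left₀ ha.ne']
    · simp [shearMap, η, mul_assoc, mul_inv_cancel_left₀ ha.ne', inv_mul_cancel_left₀ ha.ne']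
  have hη2 : η 0 ^ 2 + η 1 ^ 2 =
      A 1 1 * δ 0 ^ 2 - 2 * A 0 1 * δ 0 * δ 1 + A 0 0 * δ 1 ^ 2 := by
    have hw : A 1 1 = (1 + A 0 1 ^ 2) / a ^ 2 := by
      rw [hsq]
      field_simp
      linarith
    simp only [η, Matrix.cons_val_zero, Matrix.cons_val_one, hw, hk, ← hsq]
    field_simp
    ring
  have hVη := gaussianUnitary_mul_displacement ha k ξ η
  rw [hη, ← hV_def] at hVη
  clear_value V
  set p := Complex.exp (Complex.I * ((ξ 1 * δ 0 - ξ 0 * δ 1 : ℝ) : ℂ)) with hp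
  have hpp : p * star p = 1 := by
    have : star p = conj p := rfl
    rw [this, Complex.mul_conj', hp, mul_comm Complex.I, Complex.norm_exp_ofReal_mul_I]
    simp
  set W := V * displacement η with hW_def
  have hW : W ∈ unitary (BoundedOp Mode) := mul_mem hV (displacement_mem_unitary η)
  obtain ⟨hW1, hW2⟩ := Unitary.mem_iff.1 hW
  set τ := (c : ℂ) • mehlerOp β with hτ
  have h1 : ρ₁ = W * τ * star W := by
    rw [hVη, star_smul, smul_mul_assoc, smul_mul_assoc, mul_smul_comm, smul_smul, hpp, one_smul,
      hρ₁, h0, star_mul, ContinuousLinearMap.star_eq_adjoint (displacement δ)]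
    simp only [mul_assoc]
  have hτ0 : 0 ≤ τ := by
    have := smul_nonneg hc.le (mehlerOp_nonneg hβ)
    simpa [hτ] using this
  have e0 : ρ₀ ^ s = V * (((c ^ s : ℝ) : ℂ) • mehlerOp (s * β)) * star V := by
    rw [h0, ← smul_mehlerOp_rpow hc hβ hs.1]
    exact rpow_conj hτ0 hV1 hV2 hs.1.le
  have e1 : ρ₁ ^ (1 - s) = W * (((c ^ (1 - s) : ℝ) : ℂ) • mehlerOp ((1 - s) * β)) * star W := by
    rw [h1, ← smul_mehlerOp_rpow hc hβ hs1]
    exact rpow_conj hτ0 hW1 hW2 hs1.le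
  have e2 : ρ₀ ^ s * ρ₁ ^ (1 - s) = V * ((c : ℂ) • (mehlerOp (s * β) * (displacement η *
      mehlerOp ((1 - s) * β) * ContinuousLinearMap.adjoint (displacement η)))) *
        ContinuousLinearMap.adjoint V := by
    have hcc : (c : ℂ) = ((c ^ s : ℝ) : ℂ) * ((c ^ (1 - s) : ℝ) : ℂ) := by
      rw [← Complex.ofReal_mul, ← Real.rpow_add hc, add_sub_cancel, Real.rpow_one]
    rw [e0, e1, hW_def, star_mul, hcc, ← smul_smul]
    simp only [mul_smul_comm, smul_mul_assoc, ← ContinuousLinearMap.star_eq_adjoint]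
    rw [smul_comm]
    congr 2
    calc _ = V * mehlerOp (s * β) * (star V * V) * (displacement η * mehlerOp ((1 - s) * β) *
          star (displacement η)) * star V := by simp only [mul_assoc]
      _ = _ := by rw [hV1, mul_one]; simp only [mul_assoc]
  rw [e2, ← hη2]
  have h := ((hasTrace_mehlerOp_mul_displaced (mul_pos hs.1 hβ) (mul_pos hs1 hβ) η).smul c).conj hV1
  convert h using 1
  rw [← Complex.ofReal_mul, ← mul_assoc, show (s * β + (1 - s) * β) / 2 = β / 2 by ring, ← hc_def,
    mul_inv_cancel₀ hc.ne', one_mul]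

/-! ### The matrices and the thermal functions -/

theorem rot_transpose_mul_self (φ : ℝ) : (rot φ)ᵀ * rot φ = 1 := by
  ext i j
  fin_cases i <;> fin_cases j <;>
    simp [rot, Matrix.mul_apply, Fin.sum_univ_two] <;> nlinarith [Real.sin_sq_add_cos_sq φ]

theorem rot_mul_transpose_self (φ : ℝ) : rot φ * (rot φ)ᵀ = 1 :=
  mul_eq_one_comm.1 (rot_transpose_mul_self φ)

theorem diagSqueeze_mul (r s : ℝ) : diagSqueeze r * diagSqueeze s = diagSqueeze (r + s) := by
  ext i j
  fin_cases i <;> fin_cases j <;>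
    simp [diagSqueeze, Matrix.mul_apply, Fin.sum_univ_two, Real.exp_add, mul_comm]

theorem diagSqueeze_zero : diagSqueeze 0 = 1 := by
  ext i j
  fin_cases i <;> fin_cases j <;> simp [diagSqueeze]

theorem diagSqueeze_inv (r : ℝ) : (diagSqueeze r)⁻¹ = diagSqueeze (-r) :=
  Matrix.inv_eq_right_inv (by rw [diagSqueeze_mul, add_neg_cancel, diagSqueeze_zero])

theorem squeezeCov_eq (r φ : ℝ) : squeezeCov r φ = rot φ * diagSqueeze (2 * r) * (rot φ)ᵀ := by
  have hD : (diagSqueeze r)ᵀ = diagSqueeze r := by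
    ext i j
    fin_cases i <;> fin_cases j <;> simp [diagSqueeze]
  rw [squeezeCov, squeeze, Matrix.transpose_mul, Matrix.transpose_mul, Matrix.transpose_transpose,
    hD, two_mul, ← diagSqueeze_mul]
  calc _ = rot φ * diagSqueeze r * ((rot φ)ᵀ * rot φ) * diagSqueeze r * (rot φ)ᵀ := by
        simp only [mul_assoc]
    _ = _ := by rw [rot_transpose_mul_self, mul_one]; simp only [mul_assoc]

theorem squeezeCov_inv (r φ : ℝ) :
    (squeezeCov r φ)⁻¹ = rot φ * diagSqueeze (-(2 * r)) * (rot φ)ᵀ := by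
  refine Matrix.inv_eq_right_inv ?_
  rw [squeezeCov_eq]
  calc _ = rot φ * (diagSqueeze (2 * r) * ((rot φ)ᵀ * rot φ) * diagSqueeze (-(2 * r))) *
        (rot φ)ᵀ := by simp only [mul_assoc]
    _ = _ := by
      rw [rot_transpose_mul_self, mul_one, diagSqueeze_mul, add_neg_cancel, diagSqueeze_zero,
        mul_one, rot_mul_transpose_self]

theorem det_squeezeCov (r φ : ℝ) : (squeezeCov r φ).det = 1 := by
  have h : (diagSqueeze (2 * r)).det = 1 := by
    simp [diagSqueeze, Matrix.det_fin_two, ← Real.exp_add]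
  rw [squeezeCov_eq, Matrix.det_mul, Matrix.det_mul, h, mul_one, ← Matrix.det_mul,
    rot_mul_transpose_self, Matrix.det_one]

theorem squeezeCov_zero_zero (r φ : ℝ) : squeezeCov r φ 0 0 =
    Real.exp (2 * r) * Real.cos φ ^ 2 + Real.exp (-(2 * r)) * Real.sin φ ^ 2 := by
  rw [squeezeCov_eq]
  simp [rot, diagSqueeze, Matrix.mul_apply, Fin.sum_univ_two]
  ring

theorem squeezeCov_zero_zero_pos (r φ : ℝ) : 0 < squeezeCov r φ 0 0 := by
  rw [squeezeCov_zero_zero]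
  have h := Real.sin_sq_add_cos_sq φ
  have h1 := Real.exp_pos (2 * r)
  have h2 := Real.exp_pos (-(2 * r))
  rcases eq_or_ne (Real.cos φ) 0 with hc | hc
  · have : Real.sin φ ^ 2 = 1 := by rw [hc] at h; linarith
    rw [hc, this]
    simpa using h2
  · positivity

theorem squeezeCov_symm (r φ : ℝ) : squeezeCov r φ 1 0 = squeezeCov r φ 0 1 := by
  have : (squeezeCov r φ)ᵀ = squeezeCov r φ := by
    rw [squeezeCov, Matrix.transpose_mul, Matrix.transpose_transpose]
  exact congrFun (congrFun this 0) 1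

theorem squeezeCov_entries (r φ : ℝ) :
    squeezeCov r φ 0 0 * squeezeCov r φ 1 1 - squeezeCov r φ 0 1 ^ 2 = 1 := by
  rw [← det_squeezeCov r φ, Matrix.det_fin_two, squeezeCov_symm]
  ring

theorem dotProduct_squeezeCov_inv (r φ : ℝ) (δ : Fin 2 → ℝ) :
    δ ⬝ᵥ ((squeezeCov r φ)⁻¹ *ᵥ δ) = squeezeCov r φ 1 1 * δ 0 ^ 2 -
      2 * squeezeCov r φ 0 1 * δ 0 * δ 1 + squeezeCov r φ 0 0 * δ 1 ^ 2 := by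
  rw [Matrix.inv_def, det_squeezeCov, Ring.inverse_one, one_smul, Matrix.adjugate_fin_two]
  simp [Matrix.mulVec, dotProduct, Fin.sum_univ_two, squeezeCov_symm]
  ring

theorem dotProduct_squeezeCov_inv_eq (r φ : ℝ) (δ : Fin 2 → ℝ) :
    δ ⬝ᵥ ((squeezeCov r φ)⁻¹ *ᵥ δ) =
      Real.exp (-(2 * r)) * (Real.cos φ * δ 0 - Real.sin φ * δ 1) ^ 2 +
        Real.exp (2 * r) * (Real.sin φ * δ 0 + Real.cos φ * δ 1) ^ 2 := by
  rw [squeezeCov_inv]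
  simp [rot, diagSqueeze, Matrix.mul_apply, Matrix.mulVec, dotProduct, Fin.sum_univ_two]
  ring

theorem smul_squeezeCov_inv {c : ℝ} (hc : c ≠ 0) (r φ : ℝ) :
    (c • squeezeCov r φ)⁻¹ = c⁻¹ • (squeezeCov r φ)⁻¹ := by
  refine Matrix.inv_eq_right_inv ?_
  rw [smul_mul_smul_comm, mul_inv_cancel₀ hc, one_smul,
    Matrix.mul_nonsing_inv _ (by rw [det_squeezeCov]; exact isUnit_one)]

theorem one_sub_exp_neg (x : ℝ) : 1 - Real.exp (-x) = 2 * Real.exp (-x / 2) * Real.sinh (x / 2) := by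
  have h1 : Real.exp (-x) = Real.exp (-x / 2) * Real.exp (-x / 2) := by
    rw [← Real.exp_add]; ring_nf
  have h2 : Real.exp (-x / 2) * Real.exp (x / 2) = 1 := by
    rw [← Real.exp_add]; ring_nf; exact Real.exp_zero
  rw [Real.sinh_eq, h1, ← neg_div]
  linear_combination -h2

theorem thermalNorm_mul_thermalNorm {β s : ℝ} (hβ : 0 < β) (hs : s ∈ Ioo (0 : ℝ) 1) :
    2 * thermalNorm β s * thermalNorm β (1 - s) =
      thermalGamma (s * β) + thermalGamma ((1 - s) * β) := by
  have hs1 : 0 < 1 - s := sub_pos.2 hs.2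
  have hb : 0 < 1 - Real.exp (-β) := by simpa using hβ
  have h1 : (1 - Real.exp (-β)) ^ s * (1 - Real.exp (-β)) ^ (1 - s) = 1 - Real.exp (-β) := by
    rw [← Real.rpow_add hb, add_sub_cancel, Real.rpow_one]
  have p1 : 0 < Real.sinh (s * β / 2) := Real.sinh_pos_iff.2 (by have := hs.1; positivity)
  have p2 : 0 < Real.sinh ((1 - s) * β / 2) := Real.sinh_pos_iff.2 (by positivity)
  have h2 : Real.exp (-β / 2) = Real.exp (-(β * s) / 2) * Real.exp (-(β * (1 - s)) / 2) := by
    rw [← Real.exp_add]; ring_nf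
  rw [thermalGamma_add (mul_pos hs.1 hβ) (mul_pos hs1 hβ),
    show (s * β + (1 - s) * β) / 2 = β / 2 by ring]
  calc _ = 2 * ((1 - Real.exp (-β)) ^ s * (1 - Real.exp (-β)) ^ (1 - s)) /
        ((1 - Real.exp (-(β * s))) * (1 - Real.exp (-(β * (1 - s))))) := by
        rw [thermalNorm, thermalNorm, mul_assoc, div_mul_div_comm, ← mul_div_assoc]
    _ = _ := by
      rw [h1, one_sub_exp_neg β, one_sub_exp_neg (β * s), one_sub_exp_neg (β * (1 - s)), h2,
        mul_comm β s, mul_comm β (1 - s)]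
      field_simp

/-- `γ` is midpoint convex. -/
theorem two_mul_thermalGamma_le {a b : ℝ} (ha : 0 < a) (hb : 0 < b) :
    2 * thermalGamma ((a + b) / 2) ≤ thermalGamma a + thermalGamma b := by
  have hm : 0 < (a + b) / 2 := by positivity
  have h : 2 * thermalGamma ((a + b) / 2) =
      Real.sinh ((a + b) / 2) / Real.sinh ((a + b) / 2 / 2) ^ 2 := by
    rw [two_mul, thermalGamma_add hm hm, add_halves, sq]
  have p1 : 0 < Real.sinh (a / 2) := Real.sinh_pos_iff.2 (by positivity)
  have p2 : 0 < Real.sinh (b / 2) := Real.sinh_pos_iff.2 (by positivity)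
  have p3 : 0 < Real.sinh ((a + b) / 2) := Real.sinh_pos_iff.2 hm
  rw [h, thermalGamma_add ha hb]
  refine div_le_div_of_nonneg_left p3.le (mul_pos p1 p2) ?_
  have e1 : Real.cosh ((a + b) / 2) = 1 + 2 * Real.sinh ((a + b) / 2 / 2) ^ 2 := by
    rw [cosh_eq_half ((a + b) / 2), Real.cosh_sq]
    ring
  have e2 : Real.cosh ((a + b) / 2) =
      Real.cosh (a / 2) * Real.cosh (b / 2) + Real.sinh (a / 2) * Real.sinh (b / 2) := by
    rw [add_div, Real.cosh_add]
  have e3 : Real.cosh (a / 2 - b / 2) =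
      Real.cosh (a / 2) * Real.cosh (b / 2) - Real.sinh (a / 2) * Real.sinh (b / 2) :=
    Real.cosh_sub _ _
  have e4 := Real.one_le_cosh (a / 2 - b / 2)
  linarith

end GaussianChernoff

theorem mainTheorem6 (β r φ : ℝ) (hβ : 0 < β) (ξ δ : Fin 2 → ℝ)
    (ρ₀ ρ₁ : BoundedOp Mode)
    (hρ₀ : IsGaussianState ρ₀ ξ (thermalGamma β • squeezeCov r φ))
    (hρ₁ : ρ₁ = displacement δ * ρ₀ * ContinuousLinearMap.adjoint (displacement δ)) :
    -- `Q_s` is well defined on `[0, 1]`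
    (∀ s ∈ Icc (0 : ℝ) 1, HasTrace (ρ₀ ^ s * ρ₁ ^ (1 - s)) (chernoffQ ρ₀ ρ₁ s : ℂ)) ∧
    -- the formulas for `Q_s`, with its values at the end points
    (∀ s ∈ Ioo (0 : ℝ) 1,
      chernoffQ ρ₀ ρ₁ s =
          Real.exp (-(δ ⬝ᵥ ((thermalGamma (s * β) • squeezeCov r φ +
            thermalGamma ((1 - s) * β) • squeezeCov r φ)⁻¹ *ᵥ δ))) ∧
      chernoffQ ρ₀ ρ₁ s =
          Real.exp (-((thermalGamma (s * β) + thermalGamma ((1 - s) * β))⁻¹ *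
            (δ ⬝ᵥ ((squeezeCov r φ)⁻¹ *ᵥ δ)))) ∧
      2 * thermalNorm β s * thermalNorm β (1 - s) =
          √(thermalGamma (s * β) • squeezeCov r φ +
            thermalGamma ((1 - s) * β) • squeezeCov r φ).det ∧
      2 * thermalNorm β s * thermalNorm β (1 - s) =
          thermalGamma (s * β) + thermalGamma ((1 - s) * β)) ∧
    chernoffQ ρ₀ ρ₁ 0 = 1 ∧ chernoffQ ρ₀ ρ₁ 1 = 1 ∧
    -- the minimum over `[0, 1]` is at `s = 1 / 2`
    IsLeast (chernoffQ ρ₀ ρ₁ '' Icc 0 1) (chernoffQ ρ₀ ρ₁ (1 / 2)) ∧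
    -- the formulas for the minimum `Q`
    chernoffQ ρ₀ ρ₁ (1 / 2) =
      Real.exp (-(1 / (2 * thermalGamma (β / 2)) * (δ ⬝ᵥ ((squeezeCov r φ)⁻¹ *ᵥ δ)))) ∧
    chernoffQ ρ₀ ρ₁ (1 / 2) =
      Real.exp (-(1 / 2 * (δ ⬝ᵥ ((rot φ * (diagSqueeze (2 * r))⁻¹ * (rot φ)ᵀ) *ᵥ δ)) *
        Real.tanh (β / 4))) ∧
    ∀ ϕ θ : ℝ, δ = rot ϕ *ᵥ ![√(δ ⬝ᵥ δ), 0] → θ = ϕ - φ →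
      chernoffQ ρ₀ ρ₁ (1 / 2) =
        Real.exp (-((δ ⬝ᵥ δ) / 2 *
          (Real.exp (-2 * r) * Real.cos θ ^ 2 + Real.exp (2 * r) * Real.sin θ ^ 2) *
          Real.tanh (β / 4))) := by
  have hQ {s t : ℝ} (h : HasTrace (ρ₀ ^ s * ρ₁ ^ (1 - s)) (t : ℂ)) : chernoffQ ρ₀ ρ₁ s = t := by
    rw [chernoffQ, h.opTrace_eq, Complex.ofReal_re]
  have hI : ∀ s ∈ Ioo (0 : ℝ) 1, HasTrace (ρ₀ ^ s * ρ₁ ^ (1 - s))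
      (Real.exp (-((thermalGamma (s * β) + thermalGamma ((1 - s) * β))⁻¹ *
        (δ ⬝ᵥ ((squeezeCov r φ)⁻¹ *ᵥ δ)))) : ℝ) := fun s hs => by
    rw [dotProduct_squeezeCov_inv]
    exact hasTrace_rpow_mul_rpow hβ (squeezeCov_symm r φ) (squeezeCov_zero_zero_pos r φ)
      (squeezeCov_entries r φ) hρ₀ hρ₁ hs
  have hQI s (hs : s ∈ Ioo (0 : ℝ) 1) := hQ (hI s hs)
  have hpos₀ : 0 ≤ ρ₀ := hρ₀.1.1
  have hpos₁ : 0 ≤ ρ₁ := by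
    rw [hρ₁]
    exact star_right_conjugate_nonneg hpos₀ (displacement δ)
  have htr₁ : HasTrace ρ₁ 1 := by
    rw [hρ₁]
    exact hρ₀.1.2.conj (Unitary.mem_iff.1 (displacement_mem_unitary δ)).1
  have h0 : HasTrace (ρ₀ ^ (0 : ℝ) * ρ₁ ^ (1 - (0 : ℝ))) ((1 : ℝ) : ℂ) := by
    rw [CFC.rpow_zero ρ₀ hpos₀, sub_zero, CFC.rpow_one ρ₁ hpos₁, one_mul, Complex.ofReal_one]
    exact htr₁
  have h1 : HasTrace (ρ₀ ^ (1 : ℝ) * ρ₁ ^ (1 - (1 : ℝ))) ((1 : ℝ) : ℂ) := by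
    rw [CFC.rpow_one ρ₀ hpos₀, sub_self, CFC.rpow_zero ρ₁ hpos₁, mul_one, Complex.ofReal_one]
    exact hρ₀.1.2
  have hγ {s : ℝ} (hs : s ∈ Ioo (0 : ℝ) 1) :
      0 < thermalGamma (s * β) + thermalGamma ((1 - s) * β) :=
    add_pos (thermalGamma_pos (mul_pos hs.1 hβ)) (thermalGamma_pos (mul_pos (sub_pos.2 hs.2) hβ))
  have hhalf : (1 / 2 : ℝ) ∈ Ioo (0 : ℝ) 1 := by norm_num
  have hG : 0 < thermalGamma (β / 2) := thermalGamma_pos (half_pos hβ)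
  have hmin : chernoffQ ρ₀ ρ₁ (1 / 2) =
      Real.exp (-(1 / (2 * thermalGamma (β / 2)) * (δ ⬝ᵥ ((squeezeCov r φ)⁻¹ *ᵥ δ)))) := by
    rw [hQI _ hhalf, show (1 / 2 : ℝ) * β = β / 2 by ring,
      show (1 - 1 / 2 : ℝ) * β = β / 2 by ring, ← two_mul, one_div (2 * thermalGamma (β / 2))]
  have hquad : 0 ≤ δ ⬝ᵥ ((squeezeCov r φ)⁻¹ *ᵥ δ) := by
    rw [dotProduct_squeezeCov_inv_eq]
    positivity
  have htanh : 1 / (2 * thermalGamma (β / 2)) = 1 / 2 * Real.tanh (β / 4) := by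
    rw [thermalGamma, show β / 2 / 2 = β / 4 by ring, one_div, mul_inv, inv_inv, one_div]
  refine ⟨fun s hs => ?_, fun s hs => ⟨?_, hQI s hs, ?_, thermalNorm_mul_thermalNorm hβ hs⟩,
    hQ h0, hQ h1, ⟨⟨1 / 2, Ioo_subset_Icc_self hhalf, rfl⟩, ?_⟩, hmin, ?_, ?_⟩
  · rcases eq_or_lt_of_le hs.1 with rfl | hs0
    · rw [hQ h0]; exact h0
    rcases eq_or_lt_of_le hs.2 with rfl | hs1
    · rw [hQ h1]; exact h1
    rw [hQI s ⟨hs0, hs1⟩]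
    exact hI s ⟨hs0, hs1⟩
  · rw [hQI s hs, ← add_smul, smul_squeezeCov_inv (hγ hs).ne', Matrix.smul_mulVec, dotProduct_smul,
      smul_eq_mul]
  · rw [thermalNorm_mul_thermalNorm hβ hs, ← add_smul, Matrix.det_smul, det_squeezeCov, mul_one,
      Fintype.card_fin, Real.sqrt_sq (hγ hs).le]
  · rintro _ ⟨s, hs, rfl⟩
    have hle : chernoffQ ρ₀ ρ₁ (1 / 2) ≤ 1 := by
      rw [hmin, Real.exp_le_one_iff, neg_nonpos]
      positivity
    rcases eq_or_lt_of_le hs.1 with rfl | hs0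
    · rwa [hQ h0]
    rcases eq_or_lt_of_le hs.2 with rfl | hs1
    · rwa [hQ h1]
    have hle' := two_mul_thermalGamma_le (mul_pos hs0 hβ) (mul_pos (sub_pos.2 hs1) hβ)
    rw [show (s * β + (1 - s) * β) / 2 = β / 2 by ring] at hle'
    rw [hmin, hQI s ⟨hs0, hs1⟩, Real.exp_le_exp, neg_le_neg_iff, one_div]
    gcongr
  · rw [hmin, diagSqueeze_inv, ← squeezeCov_inv, htanh]
    congr 2
    ring
  · intro ϕ θ hδ hθ
    have e0 : δ 0 = √(δ ⬝ᵥ δ) * Real.cos ϕ := by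
      have := congrFun hδ 0
      simpa [rot, Matrix.mulVec, dotProduct, Fin.sum_univ_two, mul_comm] using this
    have e1 : δ 1 = -(√(δ ⬝ᵥ δ) * Real.sin ϕ) := by
      have := congrFun hδ 1
      simpa [rot, Matrix.mulVec, dotProduct, Fin.sum_univ_two, mul_comm] using this
    have hn : √(δ ⬝ᵥ δ) ^ 2 = δ ⬝ᵥ δ := Real.sq_sqrt (by
      rw [dotProduct, Fin.sum_univ_two]
      exact add_nonneg (mul_self_nonneg _) (mul_self_nonneg _))
    have hq : δ ⬝ᵥ ((squeezeCov r φ)⁻¹ *ᵥ δ) = (δ ⬝ᵥ δ) *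
        (Real.exp (-2 * r) * Real.cos θ ^ 2 + Real.exp (2 * r) * Real.sin θ ^ 2) := by
      generalize √(δ ⬝ᵥ δ) = n at e0 e1 hn
      rw [dotProduct_squeezeCov_inv_eq, e0, e1, hθ, Real.cos_sub, Real.sin_sub, neg_mul, ← hn]
      ring
    rw [hmin, hq, htanh]
    congr 2
    ring
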